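/- Let $\Sigma\subset\mathbb{R}^3$ be a surface with a parametrization $X:\mathbb{R}^2\to\mathbb{R}^3$, $\Sigma=X(\mathbb{R}^2)$, such that: (a) $X$ is a homeomorphism of $\mathbb{R}^2$ onto $\Sigma$, and $\mathbb{R}^3\setminus\Sigma$ is the disjoint union of two open connected sets $\Omega_{\mathrm{int}}$, $\Omega_{\mathrm{ext}}$ whose common boundary is $\Sigma$; the set $\Omega_{\mathrm{int}}$ is convex and is not a half-space; (b) there is a set $S\subset\Sigma$, a union of finitely many compact $C^1$ curves ($C^1$ up to their ends) and finitely many points, such that $X$ is $C^2$ on $\mathbb{R}^2\setminus X^{-1}(S)$ and the metric tensor $g_{ij}=\partial_iX\cdot\partial_jX$ is uniformly elliptic there: $c_1|v|^2\le\sum_{i,j}g_{ij}(s)v_iv_j\le c_2|v|^2$ for all $v\in\mathbb{R}^2$ and $s\in\mathbb{R}^2\setminus X^{-1}(S)$, with constants $c_1,c_2>0$; (c) the principal curvatures of $\Sigma\setminus S$ tend to zero as the geodesic distance on $\Sigma$ from a fixed point tends to infinity; (d) there is $c>0$ such that $|X(s)-X(t)|\ge c|s-t|$ for all $s,t\in\mathbb{R}^2$.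 Let $\alpha>0$ and $V_0\ge\alpha^2$, and let $V(x)=0$ for $x\in\Omega_{\mathrm{int}}$ and $V(x)=V_0$ for $x\in\Omega_{\mathrm{ext}}$. Then the quadratic form $$q[\psi]=\|\nabla\psi\|^2+(\psi,V\psi)-\alpha\int_{\mathbb{R}^2}|\psi(X(s))|^2\,\sqrt{\det(g_{ij}(s))}\;\mathrm{d}s_1\,\mathrm{d}s_2,\qquad \psi\in H^1(\mathbb{R}^3),$$ where $\psi\circ X$ is the trace of $\psi$ on $\Sigma$, is closed and bounded from below in $L^2(\mathbb{R}^3)$, and the self-adjoint operator $H=-\Delta+V-\alpha\,\delta(x-\Sigma)$ associated with it has empty discrete spectrum (isolated eigenvalues of finite multiplicity), and $$\sigma(H)=\sigma_{\mathrm{ess}}(H)=[0,\infty),\qquad \sigma_{\mathrm{ess}}(H):=\sigma(H)\setminus\sigma_{\mathrm{disc}}(H).$$ -/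

import Mathlib

open MeasureTheory Set Filter Topology
open scoped ENNReal ContDiff SchwartzMap InnerProductSpace LineDeriv

noncomputable section

namespace SurfaceDelta

/-- The parameter plane. -/
abbrev Plane : Type := EuclideanSpace ℝ (Fin 2)

/-- The ambient Euclidean space. -/
abbrev Space : Type := EuclideanSpace ℝ (Fin 3)

/-- The Hilbert space of the problem. -/
abbrev L2 : Type := Lp ℂ 2 (volume : Measure Space)

/-! ### Geometry of a parametrized surface -/

section Surface

variable (X : Plane → Space)

/-- The coordinate tangent vector `∂ᵢX` at the parameter `s`. -/
def tangent (i : Fin 2) (s : Plane) : Space :=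
  fderiv ℝ X s (EuclideanSpace.single i 1)

/-- The metric tensor `gᵢⱼ = ⟨∂ᵢX, ∂ⱼX⟩`. -/
def metricTensor (s : Plane) : Matrix (Fin 2) (Fin 2) ℝ :=
  Matrix.of fun i j => ⟪tangent X i s, tangent X j s⟫_ℝ

/-- The unit normal `(∂₁X × ∂₂X) / |∂₁X × ∂₂X|`. -/
def unitNormal (s : Plane) : Space :=
  let n : Space :=
    WithLp.toLp 2 (crossProduct (WithLp.ofLp (tangent X 0 s)) (WithLp.ofLp (tangent X 1 s)))
  ‖n‖⁻¹ • n

/-- The second fundamental form `hᵢⱼ = ⟨∂ᵢ∂ⱼX, n⟩`. -/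
def secondForm (s : Plane) : Matrix (Fin 2) (Fin 2) ℝ :=
  Matrix.of fun i j =>
    ⟪fderiv ℝ (tangent X j) s (EuclideanSpace.single i 1), unitNormal X s⟫_ℝ

/-- The principal curvatures are the eigenvalues of the Weingarten map `g⁻¹h`, that is, the
roots `k` of `det (h - k g) = 0`. -/
def IsPrincipalCurvature (s : Plane) (k : ℝ) : Prop :=
  (secondForm X s - k • metricTensor X s).det = 0

/-- Geodesic distance of two points: the infimum of the lengths of the paths which join them
inside the surface. -/
def geodesicDist (x y : Space) : ℝ≥0∞ :=
  ⨅ (γ : Path x y) (_ : ∀ t, γ t ∈ range X), eVariationOn (fun t => γ t) univ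

/-- The surface measure `√g ds₁ ds₂`, as a measure on the parameter plane. -/
def surfaceMeasure : Measure Plane :=
  volume.withDensity fun s => ENNReal.ofReal (Real.sqrt (metricTensor X s).det)

/-- A compact `C¹` arc or loop, with `C¹` behaviour up to its ends. -/
def IsC1Curve (C : Set Space) : Prop :=
  ∃ γ : ℝ → Space, ContDiffOn ℝ 1 γ (Icc 0 1) ∧ γ '' Icc 0 1 = C

/-- `S` is a union of finitely many `C¹` curves and finitely many points of the surface. -/
def IsSingularSet (S : Set Space) : Prop :=
  ∃ (curves : Set (Set Space)) (points : Set Space), curves.Finite ∧ points.Finite ∧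
    (∀ C ∈ curves, IsC1Curve C ∧ C ⊆ range X) ∧ points ⊆ range X ∧ S = ⋃₀ curves ∪ points

/-- Two-sided bound of the metric tensor by the Euclidean one, uniformly in `s ∈ U`. -/
def UniformlyEllipticOn (U : Set Plane) : Prop :=
  ∃ c₁ c₂ : ℝ, 0 < c₁ ∧ ∀ s ∈ U, ∀ v : Plane,
    c₁ * ‖v‖ ^ 2 ≤ ∑ i, ∑ j, metricTensor X s i j * v i * v j ∧
    ∑ i, ∑ j, metricTensor X s i j * v i * v j ≤ c₂ * ‖v‖ ^ 2

/-- The principal curvatures (at the parameters in `U`) tend to zero as the geodesic distance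
from a fixed point of the surface tends to infinity. -/
def AsymptoticallyPlanarOn (U : Set Plane) : Prop :=
  ∃ s₀ : Plane, ∀ ε : ℝ, 0 < ε → ∃ R : ℝ, ∀ s ∈ U,
    ENNReal.ofReal R < geodesicDist X (X s₀) (X s) →
      ∀ k : ℝ, IsPrincipalCurvature X s k → |k| < ε

end Surface

/-- The surface `Σ = range X` divides the space into the two regions `Ωint` and `Ωext`, the
complementary domains which have `Σ` as their common boundary. -/
structure DividesSpace (X : Plane → Space) (Ωint Ωext : Set Space) : Prop where
  isOpen_int : IsOpen Ωint
  isOpen_ext : IsOpen Ωext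
  isConnected_int : IsConnected Ωint
  isConnected_ext : IsConnected Ωext
  disjoint : Disjoint Ωint Ωext
  union_eq : Ωint ∪ Ωext = (range X)ᶜ
  frontier_int : frontier Ωint = range X
  frontier_ext : frontier Ωext = range X

/-- The class of surfaces under consideration. -/
structure IsAdmissibleSurface (X : Plane → Space) (Ωint Ωext : Set Space) : Prop where
  /-- `X` is a homeomorphism of the plane onto the surface. -/
  isEmbedding : IsEmbedding X
  divides : DividesSpace X Ωint Ωext
  convex_int : Convex ℝ Ωint
  not_halfspace : ¬ ∃ (a : Space) (b : ℝ), a ≠ 0 ∧ Ωint = {x | ⟪a, x⟫_ℝ < b}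
  /-- Off finitely many `C¹` curves and points the surface is `C²`, with a uniformly elliptic
  metric tensor and with principal curvatures that vanish at infinity. -/
  regular : ∃ S : Set Space, IsSingularSet X S ∧
    ContDiffOn ℝ 2 X (X ⁻¹' Sᶜ) ∧ UniformlyEllipticOn X (X ⁻¹' Sᶜ) ∧
    AsymptoticallyPlanarOn X (X ⁻¹' Sᶜ)
  chord_bound : ∃ c : ℝ, 0 < c ∧ ∀ s t : Plane, c * ‖s - t‖ ≤ ‖X s - X t‖

/-! ### The Sobolev space `H¹` and the trace on the surface -/

/-- `G` is the gradient of `u` in the sense of (tempered) distributions. -/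
def IsWeakGradient (u : L2) (G : Fin 3 → L2) : Prop :=
  ∀ i, ∂_{(EuclideanSpace.single i 1 : Space)} (u : 𝓢'(Space, ℂ)) = (G i : 𝓢'(Space, ℂ))

/-- The Sobolev space `H¹(ℝ³)`: square integrable functions with square integrable gradient. -/
def H1 : Set L2 := {u | ∃ G : Fin 3 → L2, IsWeakGradient u G}

open Classical in
/-- The weak gradient of `u` (only meaningful for `u ∈ H1`). -/
def weakGradient (u : L2) : Fin 3 → L2 :=
  if h : ∃ G : Fin 3 → L2, IsWeakGradient u G then h.choose else 0

/-- `τ` is the trace of `u ∈ H¹(ℝ³)` on the surface, in the parameters of the surface: some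
sequence of smooth compactly supported functions converges to `u` in `H¹(ℝ³)`, while its
restrictions to the surface converge to `τ` in `L²` of the surface. -/
def IsTrace (X : Plane → Space) (u : L2) (τ : Lp ℂ 2 (surfaceMeasure X)) : Prop :=
  ∃ φ : ℕ → Space → ℂ, (∀ n, ContDiff ℝ ∞ (φ n) ∧ HasCompactSupport (φ n)) ∧
    Tendsto (fun n => eLpNorm (fun x => φ n x - u x) 2 volume) atTop (𝓝 0) ∧
    (∀ i, Tendsto (fun n => eLpNorm (fun x =>
      fderiv ℝ (φ n) x (EuclideanSpace.single i 1) - weakGradient u i x) 2 volume)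
      atTop (𝓝 0)) ∧
    Tendsto (fun n => eLpNorm (fun s => φ n (X s) - τ s) 2 (surfaceMeasure X)) atTop (𝓝 0)

open Classical in
/-- The trace of `u ∈ H¹(ℝ³)` on the surface. -/
def trace (X : Plane → Space) (u : L2) : Lp ℂ 2 (surfaceMeasure X) :=
  if h : ∃ τ, IsTrace X u τ then h.choose else 0

/-! ### The quadratic form and its operator -/

/-- The potential bias: `V₀` in the region `Ω` and zero elsewhere. -/
def bias (Ω : Set Space) (V₀ : ℝ) : Space → ℝ := Ω.indicator fun _ => V₀

/-- The sesquilinear form on `H¹(ℝ³)` whose diagonal is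
`q[ψ] = ‖∇ψ‖² + (ψ, Vψ) - α ∫ |ψ(X(s))|² √g(s) ds`. -/
def deltaForm (α : ℝ) (V : Space → ℝ) (X : Plane → Space) (φ ψ : L2) : ℂ :=
  (∑ i, ⟪weakGradient φ i, weakGradient ψ i⟫_ℂ)
    + (∫ x, (starRingEnd ℂ) (φ x) * (V x : ℂ) * ψ x)
    - (α : ℂ) * ⟪trace X φ, trace X ψ⟫_ℂ

section Operators

variable {𝓗 : Type*} [NormedAddCommGroup 𝓗] [InnerProductSpace ℂ 𝓗]

/-- The form `q` with form domain `D` is densely defined, bounded from below and closed. -/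
structure IsClosedSemiboundedForm (D : Set 𝓗) (q : 𝓗 → 𝓗 → ℂ) : Prop where
  dense : Dense D
  semibounded : ∃ C : ℝ, ∀ ψ ∈ D, -C * ‖ψ‖ ^ 2 ≤ (q ψ ψ).re
  closed : ∀ (u : ℕ → 𝓗) (v : 𝓗), (∀ n, u n ∈ D) → Tendsto u atTop (𝓝 v) →
    (∀ ε : ℝ, 0 < ε → ∃ N, ∀ m ≥ N, ∀ n ≥ N, ‖q (u m - u n) (u m - u n)‖ < ε) →
    v ∈ D ∧ Tendsto (fun n => q (u n - v) (u n - v)) atTop (𝓝 0)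

/-- `T` is the operator associated with the form `q` with form domain `D`: `ψ` is in the domain
of `T` with `Tψ = f` if and only if `ψ ∈ D` and `q(φ, ψ) = (φ, f)` for all `φ ∈ D`. This
determines `T`. -/
def IsAssociatedOperator (D : Set 𝓗) (q : 𝓗 → 𝓗 → ℂ) (T : 𝓗 →ₗ.[ℂ] 𝓗) : Prop :=
  ∀ ψ f : 𝓗, (ψ, f) ∈ T.graph ↔ ψ ∈ D ∧ ∀ φ ∈ D, q φ ψ = ⟪φ, f⟫_ℂ

/-- The spectrum of an unbounded operator: `z` is in the resolvent set when `T - z` is a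
bijection of its domain onto the whole space with a bounded inverse `R`. -/
def opSpectrum (T : 𝓗 →ₗ.[ℂ] 𝓗) : Set ℂ :=
  {z | ∃ R : 𝓗 →L[ℂ] 𝓗, ∀ ψ f : 𝓗, (ψ, f + z • ψ) ∈ T.graph ↔ ψ = R f}ᶜ

/-- The eigenspace `{ψ : Tψ = zψ}`. -/
def opEigenspace (T : 𝓗 →ₗ.[ℂ] 𝓗) (z : ℂ) : Submodule ℂ 𝓗 :=
  T.graph.comap (LinearMap.id.prod (z • LinearMap.id))

/-- The discrete spectrum: isolated points of the spectrum which are eigenvalues of finite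
multiplicity. -/
def discreteSpectrum (T : 𝓗 →ₗ.[ℂ] 𝓗) : Set ℂ :=
  {z | z ∈ opSpectrum T ∧ (∃ ε : ℝ, 0 < ε ∧ ∀ w ∈ opSpectrum T, dist w z < ε → w = z) ∧
    opEigenspace T z ≠ ⊥ ∧ FiniteDimensional ℂ (opEigenspace T z)}

/-- The essential spectrum of a self-adjoint operator: the rest of the spectrum. -/
def essentialSpectrum (T : 𝓗 →ₗ.[ℂ] 𝓗) : Set ℂ := opSpectrum T \ discreteSpectrum T

end Operators

end SurfaceDelta

end

/-! The theorem combines a sharp trace inequality on the exterior side of the surface with the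
presence of large balls on the convex side.

**Nonnegativity and closedness.** Let `ν` be the normal which points out of `Ωint`. Because `Ωint`
is convex, the half-lines `t ↦ X(s) + t ν(s)`, `t > 0`, lie in `Ωext` and are disjoint
(`injOn_normalMap`: `X(s)` is the nearest point of the closure of `Ωint`), and `ν` is a monotone
function of the point of the surface. The monotonicity gives that the Jacobian of
`(s, t) ↦ X(s) + t ν(s)` is at least `√g` (`gram_le_abs_det`). Writing `|φ(X(s))|²` as the integral
of `-∂ₜ|φ|²` along the half-line yields `∫ |φ ∘ X|² √g ≤ ∫_Ωext 2 |φ| |∇φ|` for test functions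
(`IsAdmissibleSurface.lintegral_trace_le`; the singular set is a null set of parameters). With
`2 t |φ| |∇φ| ≤ |∇φ|² + t² |φ|²` this becomes
`t ‖φ ∘ X‖² ≤ ‖∇φ‖² + t² ‖φ‖²_Ωext` for each `t > 0`, and it extends to `H¹` because test functions
are dense there (`denseRange_testToSobolev`). The choice `t = α` gives `q ≥ 0` as `V₀ ≥ α²`, and
`t = 2 α` leaves half of the gradient to control the norm of `H¹`, so that `q` is closed. The
representation theorem (`exists_selfAdjoint_of_form`) then provides a self-adjoint operator with
spectrum in `[0, ∞)`.

**The spectrum is all of `[0, ∞)`.** `Ωint` contains balls of any radius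
(`IsAdmissibleSurface.exists_ball_subset`). Being unbounded and convex, it contains long
segments. If it contained no large flat discs, a section orthogonal to a long segment would cut the
surface in a bounded set of parameters which separates far away points of the plane; if it
contained large discs but no large balls, then points of the surface on the two sides of a disc
would be close in space but have parameters far apart, against the chord bound. The parameters
control the distance in space because `X` is Lipschitz at large scale
(`norm_sub_le_of_fderiv_le_off`). Wave packets supported in these balls have no trace
and do not meet the potential, so the operator acts on them as `-Δ`, and they form a Weyl sequence
for each `k²` (`ofReal_sq_mem_opSpectrum`). As `[0, ∞)` has no isolated points, the
discrete spectrum is empty. -/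

noncomputable section

namespace SurfaceDelta

/-! ### Operators defined by nonnegative closed forms -/

section AbstractForm

variable {𝓗 : Type*} [NormedAddCommGroup 𝓗] [InnerProductSpace ℂ 𝓗]

/-- The linear relation `{(ψ, f) : ψ = R (f + ψ)}`, that is, the graph of `R⁻¹ - 1`. -/
def inverseSubOneGraph (R : 𝓗 →L[ℂ] 𝓗) : Submodule ℂ (𝓗 × 𝓗) where
  carrier := {p | p.1 = R (p.2 + p.1)}
  add_mem' := by
    intro p p' h h'
    simp only [mem_ofPred_eq, Prod.fst_add, Prod.snd_add, map_add] at *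
    nth_rw 1 [h, h']
    abel
  zero_mem' := by simp
  smul_mem' := by
    intro c p h
    simp only [mem_ofPred_eq, Prod.smul_fst, Prod.smul_snd, map_add, map_smul] at *
    nth_rw 1 [h]
    simp

theorem mem_inverseSubOneGraph {R : 𝓗 →L[ℂ] 𝓗} {ψ f : 𝓗} :
    (ψ, f) ∈ inverseSubOneGraph R ↔ ψ = R (f + ψ) := Iff.rfl

/-- The unbounded operator `R⁻¹ - 1` on the range of `R`. It is only meaningful for an injective
`R`, whose relation `inverseSubOneGraph R` is the graph of an operator. -/
def inverseSubOne (R : 𝓗 →L[ℂ] 𝓗) : 𝓗 →ₗ.[ℂ] 𝓗 := (inverseSubOneGraph R).toLinearPMap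

theorem graph_inverseSubOne {R : 𝓗 →L[ℂ] 𝓗} (hinj : Function.Injective R) :
    (inverseSubOne R).graph = inverseSubOneGraph R := by
  refine Submodule.toLinearPMap_graph_eq _ fun x hx h0 => ?_
  obtain ⟨ψ, f⟩ := x
  rw [mem_inverseSubOneGraph] at hx
  simp only at h0
  subst h0
  apply hinj
  simpa using hx.symm

theorem mem_graph_inverseSubOne {R : 𝓗 →L[ℂ] 𝓗} (hinj : Function.Injective R) {ψ f : 𝓗} :
    (ψ, f) ∈ (inverseSubOne R).graph ↔ ψ = R (f + ψ) := by
  rw [graph_inverseSubOne hinj, mem_inverseSubOneGraph]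

variable [CompleteSpace 𝓗]

theorem dense_domain_inverseSubOne {R : 𝓗 →L[ℂ] 𝓗} (hinj : Function.Injective R)
    (hsymm : ∀ v w, ⟪R v, w⟫_ℂ = ⟪v, R w⟫_ℂ) :
    Dense ((inverseSubOne R).domain : Set 𝓗) := by
  rw [Submodule.dense_iff_topologicalClosure_eq_top,
    Submodule.topologicalClosure_eq_top_iff, Submodule.eq_bot_iff]
  intro v hv
  apply hinj
  rw [map_zero, ← inner_self_eq_zero (𝕜 := ℂ)]
  rw [hsymm, ← inner_conj_symm, map_eq_zero]
  refine hv _ ?_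
  rw [LinearPMap.mem_domain_iff]
  exact ⟨R v - R (R v), by rw [mem_graph_inverseSubOne hinj, sub_add_cancel]⟩

theorem isSelfAdjoint_inverseSubOne {R : 𝓗 →L[ℂ] 𝓗} (hinj : Function.Injective R)
    (hsymm : ∀ v w, ⟪R v, w⟫_ℂ = ⟪v, R w⟫_ℂ) : IsSelfAdjoint (inverseSubOne R) := by
  rw [LinearPMap.isSelfAdjoint_def]
  apply LinearPMap.eq_of_eq_graph
  rw [LinearPMap.adjoint_graph_eq_graph_adjoint (dense_domain_inverseSubOne hinj hsymm)]
  ext ⟨y, w⟩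
  rw [Submodule.mem_adjoint_iff, mem_graph_inverseSubOne hinj]
  constructor
  · intro h
    rw [← sub_eq_zero]
    refine ext_inner_left ℂ fun v => ?_
    have := h (R v) (v - R v) (by rw [mem_graph_inverseSubOne hinj, sub_add_cancel])
    simp only [inner_sub_left, inner_zero_right, inner_sub_right, map_add, inner_add_right,
      ← hsymm] at this ⊢
    linear_combination this
  · intro h a b hab
    rw [mem_graph_inverseSubOne hinj] at hab
    simp only
    have h1 : ⟪b + a, y⟫_ℂ = ⟪a, w + y⟫_ℂ := by
      conv_lhs => rw [h, ← hsymm, ← hab]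
    rw [inner_add_left, inner_add_right] at h1
    linear_combination h1

/-- For a bounded symmetric `R` with `‖Rv‖² ≤ ⟨Rv, v⟩` one has `0 ≤ R ≤ 1`, so that `R⁻¹ - 1` has
its spectrum in `[0, ∞)`. -/
theorem opSpectrum_inverseSubOne_subset {R : 𝓗 →L[ℂ] 𝓗} (hinj : Function.Injective R)
    (hsymm : ∀ v w, ⟪R v, w⟫_ℂ = ⟪v, R w⟫_ℂ) (hR : ∀ v, ‖R v‖ ^ 2 ≤ (⟪R v, v⟫_ℂ).re) :
    opSpectrum (inverseSubOne R) ⊆ Complex.ofReal '' Ici 0 := by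
  intro z hz
  by_contra hz0
  apply hz
  -- `1 - (1 + z) ρ` does not vanish for `ρ ∈ [0, 1]`, hence is bounded away from zero
  obtain ⟨ρ₀, hρ₀mem, hρ₀⟩ := (isCompact_Icc (a := (0 : ℝ)) (b := 1)).exists_isMinOn
    (nonempty_Icc.2 zero_le_one)
    (f := fun ρ : ℝ => ‖(1 : ℂ) - (1 + z) * ρ‖) (by fun_prop)
  have hpos : ∀ ρ ∈ Icc (0 : ℝ) 1, 0 < ‖(1 : ℂ) - (1 + z) * ρ‖ := by
    intro ρ hρ
    rw [norm_pos_iff]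
    intro h0
    have hρ0 : ρ ≠ 0 := by
      rintro rfl
      simp at h0
    refine hz0 ⟨ρ⁻¹ - 1, ?_, ?_⟩
    · rw [mem_Ici, sub_nonneg]
      exact (one_le_inv₀ (lt_of_le_of_ne hρ.1 (Ne.symm hρ0))).2 hρ.2
    · push_cast
      have : (ρ : ℂ) ≠ 0 := by exact_mod_cast hρ0
      field_simp
      linear_combination h0
  set c : ℝ := ‖(1 : ℂ) - (1 + z) * ρ₀‖ with hc
  have hc0 : 0 < c := hpos ρ₀ hρ₀mem
  have hRle : ∀ v, ‖R v‖ ≤ ‖v‖ := by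
    intro v
    rcases eq_or_ne (R v) 0 with h | h
    · simp [h]
    · have h1 := (hR v).trans (Complex.re_le_norm _)
      have h2 := h1.trans (norm_inner_le_norm (R v) v)
      have h3 : 0 < ‖R v‖ := norm_pos_iff.2 h
      nlinarith
  have hunit : IsUnit (1 - (1 + z) • R) := by
    refine ContinuousLinearMap.isUnit_of_forall_le_norm_inner_map _ (c := ⟨c, hc0.le⟩) hc0 ?_
    intro x
    have hreal : ⟪R x, x⟫_ℂ = ((⟪R x, x⟫_ℂ).re : ℂ) := by
      rw [eq_comm, ← Complex.conj_eq_iff_re, inner_conj_symm, hsymm]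
    rcases eq_or_ne x 0 with rfl | hx
    · simp
    have hx2 : 0 < ‖x‖ ^ 2 := by positivity
    set r := (⟪R x, x⟫_ℂ).re with hr
    have hr0 : 0 ≤ r := le_trans (by positivity) (hR x)
    have hr1 : r ≤ ‖x‖ ^ 2 := by
      refine (Complex.re_le_norm _).trans ((norm_inner_le_norm (R x) x).trans ?_)
      have := hRle x
      nlinarith [norm_nonneg x]
    have hmin := hρ₀ (show r / ‖x‖ ^ 2 ∈ Icc (0 : ℝ) 1 from
      ⟨by positivity, by rwa [div_le_one hx2]⟩)
    have hcalc : ⟪x, (1 - (1 + z) • R) x⟫_ℂ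
        = (‖x‖ ^ 2 : ℝ) * ((1 : ℂ) - (1 + z) * ((r / ‖x‖ ^ 2 : ℝ) : ℂ)) := by
      have hx2' : ((‖x‖ : ℝ) : ℂ) ≠ 0 := by exact_mod_cast (norm_ne_zero_iff.2 hx)
      simp only [sub_apply, one_apply_eq_self,
        smul_apply, inner_sub_right, inner_smul_right, ← hsymm x x, hreal,
        inner_self_eq_norm_sq_to_K]
      push_cast
      field_simp
      simp
    rw [norm_inner_symm, hcalc, norm_mul, Complex.norm_real, Real.norm_of_nonneg hx2.le]
    exact mul_le_mul_of_nonneg_left hmin hx2.le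
  -- the resolvent is `(1 - (1 + z) R)⁻¹ R`
  obtain ⟨N, hN⟩ := hunit
  refine ⟨(↑N⁻¹ : 𝓗 →L[ℂ] 𝓗) ∘L R, fun ψ f => ?_⟩
  rw [mem_graph_inverseSubOne hinj]
  have key : (ψ = R (f + z • ψ + ψ)) ↔ (N : 𝓗 →L[ℂ] 𝓗) ψ = R f := by
    rw [hN, sub_apply, one_apply_eq_self,
      smul_apply, sub_eq_iff_eq_add, add_assoc, map_add, map_add, map_smul,
      add_smul, one_smul, add_comm (z • R ψ)]
  rw [key]
  constructor
  · intro h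
    rw [ContinuousLinearMap.comp_apply, ← h, ← mul_apply_eq_comp, Units.inv_mul]
    rfl
  · intro h
    rw [h, ContinuousLinearMap.comp_apply, ← mul_apply_eq_comp, Units.mul_inv]
    rfl

variable {W : Type*} [NormedAddCommGroup W] [InnerProductSpace ℂ W] [CompleteSpace W]

/-- The representation theorem for a nonnegative closed form: the form is given on the form
domain, the range of an injective bounded map `J` with dense range, by a bounded symmetric
operator `a` on a Hilbert space `W`. -/
theorem exists_selfAdjoint_of_form (J : W →L[ℂ] 𝓗) (hJ : Function.Injective J)
    (hJd : DenseRange J) (a : W →L[ℂ] W) (ha : ∀ v w, ⟪a v, w⟫_ℂ = ⟪v, a w⟫_ℂ)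
    (hnn : ∀ v, 0 ≤ (⟪v, a v⟫_ℂ).re) {c : ℝ} (hc : 0 < c)
    (hco : ∀ v, c * ‖v‖ ^ 2 ≤ (⟪v, a v⟫_ℂ).re + ‖J v‖ ^ 2)
    (q : 𝓗 → 𝓗 → ℂ) (hq : ∀ v w, q (J v) (J w) = ⟪v, a w⟫_ℂ) :
    ∃ T : 𝓗 →ₗ.[ℂ] 𝓗, IsAssociatedOperator (range J) q T ∧ IsSelfAdjoint T ∧
      opSpectrum T ⊆ Complex.ofReal '' Ici 0 := by
  -- `A` represents the form `q + 1`, which is coercive, and `J A⁻¹ J†` is the inverse of `T + 1`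
  let Jd : 𝓗 →L[ℂ] W := ContinuousLinearMap.adjoint J
  let A : W →L[ℂ] W := a + Jd ∘L J
  have hA : ∀ v w, ⟪v, A w⟫_ℂ = ⟪v, a w⟫_ℂ + ⟪J v, J w⟫_ℂ := by
    intro v w
    simp [A, Jd, ContinuousLinearMap.adjoint_inner_right]
  have hAsymm : ∀ v w, ⟪A v, w⟫_ℂ = ⟪v, A w⟫_ℂ := by
    intro v w
    rw [← inner_conj_symm, hA, hA, map_add, inner_conj_symm, inner_conj_symm, ha]
  have hAunit : IsUnit A := by
    refine ContinuousLinearMap.isUnit_of_forall_le_norm_inner_map _ (c := ⟨c, hc.le⟩) hc ?_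
    intro x
    rw [norm_inner_symm]
    refine le_trans ?_ (Complex.re_le_norm _)
    rw [hA, Complex.add_re, inner_self_eq_norm_sq_to_K]
    have := hco x
    norm_cast
    rw [mul_comm]
    exact this
  obtain ⟨N, hN⟩ := hAunit
  let B : W →L[ℂ] W := (↑N⁻¹ : W →L[ℂ] W)
  have hAB : ∀ w, A (B w) = w := fun w => by
    rw [← hN, ← mul_apply_eq_comp, Units.mul_inv]; rfl
  have hBA : ∀ w, B (A w) = w := fun w => by
    rw [← hN, ← mul_apply_eq_comp, Units.inv_mul]; rfl
  let R : 𝓗 →L[ℂ] 𝓗 := J ∘L B ∘L Jd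
  have hRdef : ∀ g, R g = J (B (Jd g)) := fun g => rfl
  -- `⟨R g, h⟩` is the form `q + 1` of `R g` and `R h`
  have hRin : ∀ g h, ⟪R g, h⟫_ℂ = ⟪B (Jd g), A (B (Jd h))⟫_ℂ := by
    intro g h
    rw [hAB, hRdef, ContinuousLinearMap.adjoint_inner_right]
  have hRsymm : ∀ v w, ⟪R v, w⟫_ℂ = ⟪v, R w⟫_ℂ := by
    intro v w
    rw [← inner_conj_symm v, hRin, hRin, inner_conj_symm, hAsymm]
  have hRinj : Function.Injective R := by
    refine (injective_iff_map_eq_zero R).2 fun g hg => ?_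
    have h1 : B (Jd g) = 0 := hJ (by rw [map_zero]; exact hg)
    have h2 : Jd g = 0 := by rw [← hAB (Jd g), h1, map_zero]
    refine hJd.eq_zero_of_inner_right ℂ ?_
    intro w
    rw [← ContinuousLinearMap.adjoint_inner_right]
    change ⟪w, Jd g⟫_ℂ = 0
    rw [h2, inner_zero_right]
  have hRsq : ∀ v, ‖R v‖ ^ 2 ≤ (⟪R v, v⟫_ℂ).re := by
    intro v
    rw [hRin, hA, Complex.add_re, ← hRdef, ← RCLike.re_eq_complex_re,
      inner_self_eq_norm_sq]
    exact le_add_of_nonneg_left (hnn (B (Jd v)))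
  refine ⟨inverseSubOne R, ?_, isSelfAdjoint_inverseSubOne hRinj hRsymm,
    opSpectrum_inverseSubOne_subset hRinj hRsymm hRsq⟩
  intro ψ f
  rw [mem_graph_inverseSubOne hRinj]
  constructor
  · intro h
    refine ⟨⟨_, h.symm⟩, ?_⟩
    rintro _ ⟨v, rfl⟩
    set w := B (Jd (f + ψ)) with hw
    have hψ : ψ = J w := h
    have h1 : ⟪v, A w⟫_ℂ = ⟪J v, f + ψ⟫_ℂ := by
      rw [hw, hAB, ContinuousLinearMap.adjoint_inner_right]
    rw [hA, inner_add_right, ← hψ] at h1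
    rw [hψ, hq]
    exact add_right_cancel h1
  · rintro ⟨⟨w, rfl⟩, h⟩
    have h1 : A w = Jd (f + J w) := by
      refine ext_inner_left ℂ fun v => ?_
      rw [hA, ← hq, h _ ⟨v, rfl⟩, ContinuousLinearMap.adjoint_inner_right, inner_add_right]
    rw [hRdef, ← h1, hBA]

end AbstractForm

/-! ### Unbounded convex regions and large balls -/

section LargeBalls

/-- A segment which leaves a set meets its frontier. -/
theorem exists_mem_frontier_of_notMem {E : Type*} [NormedAddCommGroup E] [NormedSpace ℝ E]
    {Ω : Set E} {x v : E} (hx : x ∈ Ω) (hv : x + v ∉ Ω) :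
    ∃ r ∈ Icc (0 : ℝ) 1, x + r • v ∈ frontier Ω := by
  let γ : Icc (0 : ℝ) 1 → E := fun r => x + (r : ℝ) • v
  have hγ : Continuous γ := by fun_prop
  have hne : (frontier (γ ⁻¹' Ω)).Nonempty := by
    rw [nonempty_frontier_iff]
    refine ⟨⟨⟨0, by simp⟩, by simpa [γ] using hx⟩, fun h => ?_⟩
    have : (⟨1, by simp⟩ : Icc (0 : ℝ) 1) ∈ γ ⁻¹' Ω := by rw [h]; trivial
    exact hv (by simpa [γ] using this)
  obtain ⟨r, hr⟩ := hne
  exact ⟨r, r.2, hγ.frontier_preimage_subset _ hr⟩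

theorem isPreconnected_compl_closedBall {E : Type*} [NormedAddCommGroup E] [NormedSpace ℝ E]
    (h : 1 < Module.rank ℝ E) (x : E) {r : ℝ} (hr : 0 ≤ r) :
    IsPreconnected (Metric.closedBall x r)ᶜ := by
  have hs := (isConnected_sphere h (0 : E) zero_le_one).isPreconnected
  have hp := (hs.prod (isPreconnected_Ioi (a := r))).image
    (fun p : E × ℝ => x + p.2 • p.1) (by fun_prop)
  convert hp using 1
  ext y
  simp only [mem_compl_iff, Metric.mem_closedBall, not_le, mem_image, mem_prod,
    mem_sphere_zero_iff_norm, mem_Ioi, Prod.exists, dist_eq_norm]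
  constructor
  · intro hy
    have h0 : ‖y - x‖ ≠ 0 := (lt_of_le_of_lt hr hy).ne'
    refine ⟨‖y - x‖⁻¹ • (y - x), ‖y - x‖, ⟨?_, hy⟩, ?_⟩
    · rw [norm_smul, norm_inv, norm_norm, inv_mul_cancel₀ h0]
    · rw [smul_smul, mul_inv_cancel₀ h0, one_smul, add_sub_cancel]
  · rintro ⟨a, b, ⟨ha, hb⟩, rfl⟩
    rw [add_sub_cancel_left, norm_smul, ha, mul_one, Real.norm_of_nonneg (hr.trans hb.le)]
    exact hb

/-- A continuous map whose derivative is bounded by `L` off a closed set, and which maps this set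
into a ball of radius `D`, is Lipschitz at large scale: the projection of a curve to the line
through its end points covers the segment between them, and its part in the exceptional set
covers a set of measure at most `2 D`. -/
theorem norm_sub_le_of_fderiv_le_off {E F : Type*} [NormedAddCommGroup E] [NormedSpace ℝ E]
    [NormedAddCommGroup F] [InnerProductSpace ℝ F] {X : E → F} {N : Set E} {L D : ℝ}
    (hX : Continuous X) (hN : IsClosed N) (hL : 0 ≤ L) (hD : 0 ≤ D)
    (hd : ∀ s ∉ N, DifferentiableAt ℝ X s) (hb : ∀ s ∉ N, ‖fderiv ℝ X s‖ ≤ L)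
    (hND : ∀ s ∈ N, ‖X s‖ ≤ D) (s t : E) : ‖X s - X t‖ ≤ L * ‖s - t‖ + 2 * D := by
  set e : F := X s - X t with he
  rcases eq_or_ne e 0 with h0 | h0
  · rw [h0, norm_zero]; positivity
  have hepos : 0 < ‖e‖ := norm_pos_iff.2 h0
  let γ : ℝ → E := fun τ => t + τ • (s - t)
  have hγ : Continuous γ := by fun_prop
  have hγd : ∀ τ, HasDerivAt γ (s - t) τ := fun τ => by
    have h := ((hasDerivAt_id τ).smul_const (s - t)).const_add t
    rwa [one_smul] at h
  let f : ℝ → ℝ := fun τ => ⟪e, X (γ τ)⟫_ℝ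
  have hf : Continuous f := by fun_prop
  let A : Set ℝ := Icc 0 1 ∩ γ ⁻¹' Nᶜ
  have hA : MeasurableSet A :=
    measurableSet_Icc.inter (hN.isOpen_compl.preimage hγ).measurableSet
  have hfd : ∀ τ ∈ A, HasDerivWithinAt f ⟪e, fderiv ℝ X (γ τ) (s - t)⟫_ℝ A τ := by
    intro τ hτ
    have h1 := ((hd _ hτ.2).hasFDerivAt.comp_hasDerivAt τ (hγd τ))
    have h2 := (innerSL ℝ e).hasFDerivAt.comp_hasDerivAt τ h1
    exact h2.hasDerivWithinAt
  have hvolA : volume (f '' A) ≤ ENNReal.ofReal (‖e‖ * (L * ‖s - t‖)) := by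
    refine (addHaar_image_le_lintegral_abs_det_fderiv volume hA
      fun τ hτ => (hfd τ hτ).hasFDerivWithinAt).trans ?_
    calc ∫⁻ τ in A, ENNReal.ofReal
          |(ContinuousLinearMap.toSpanSingleton ℝ ⟪e, fderiv ℝ X (γ τ) (s - t)⟫_ℝ).det|
        ≤ ∫⁻ _ in A, ENNReal.ofReal (‖e‖ * (L * ‖s - t‖)) := by
          refine setLIntegral_mono measurable_const fun τ hτ => ?_
          rw [ContinuousLinearMap.det_toSpanSingleton]
          refine ENNReal.ofReal_le_ofReal ((abs_real_inner_le_norm _ _).trans ?_)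
          gcongr
          exact (ContinuousLinearMap.le_opNorm _ _).trans
            (mul_le_mul_of_nonneg_right (hb _ hτ.2) (norm_nonneg _))
      _ ≤ ENNReal.ofReal (‖e‖ * (L * ‖s - t‖)) * volume (Icc (0 : ℝ) 1) := by
          rw [setLIntegral_const]
          gcongr
          exact inter_subset_left
      _ = _ := by simp
  have hcover : Icc (f 0) (f 1) ⊆ f '' A ∪ Icc (-(‖e‖ * D)) (‖e‖ * D) := by
    refine (intermediate_value_Icc zero_le_one hf.continuousOn).trans ?_
    rintro _ ⟨τ, hτ, rfl⟩
    by_cases hτN : γ τ ∈ N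
    · right
      rw [mem_Icc, ← abs_le]
      exact (abs_real_inner_le_norm _ _).trans
        (mul_le_mul_of_nonneg_left (hND _ hτN) (norm_nonneg _))
    · exact Or.inl ⟨τ, ⟨hτ, hτN⟩, rfl⟩
  have hlen : f 1 - f 0 = ‖e‖ ^ 2 := by
    simp only [f, γ, one_smul, zero_smul, add_zero, add_sub_cancel]
    rw [← inner_sub_right, ← he, real_inner_self_eq_norm_sq]
  have hmeas : ENNReal.ofReal (‖e‖ ^ 2)
      ≤ ENNReal.ofReal (‖e‖ * (L * ‖s - t‖) + 2 * (‖e‖ * D)) := by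
    calc ENNReal.ofReal (‖e‖ ^ 2) = volume (Icc (f 0) (f 1)) := by
          rw [Real.volume_Icc, hlen]
      _ ≤ volume (f '' A) + volume (Icc (-(‖e‖ * D)) (‖e‖ * D)) :=
          (measure_mono hcover).trans (measure_union_le _ _)
      _ ≤ ENNReal.ofReal (‖e‖ * (L * ‖s - t‖)) + ENNReal.ofReal (2 * (‖e‖ * D)) := by
          gcongr
          rw [Real.volume_Icc]
          gcongr
          linarith
      _ = _ := (ENNReal.ofReal_add (by positivity) (by positivity)).symm
  rw [ENNReal.ofReal_le_ofReal_iff (by positivity)] at hmeas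
  have : ‖e‖ * ‖e‖ ≤ ‖e‖ * (L * ‖s - t‖ + 2 * D) := by linarith
  exact le_of_mul_le_mul_left this hepos

/-- A unit vector orthogonal to a given vector of the space. -/
theorem exists_unit_orthogonal (u : Space) : ∃ w : Space, ‖w‖ = 1 ∧ ⟪u, w⟫_ℝ = 0 := by
  have h : ∃ w ∈ (ℝ ∙ u)ᗮ, w ≠ 0 := by
    rw [← Submodule.ne_bot_iff]
    intro h
    have h1 := Submodule.finrank_add_finrank_orthogonal (ℝ ∙ u)
    have h2 := finrank_span_le_card (R := ℝ) ({u} : Set Space)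
    rw [h, finrank_bot, finrank_euclideanSpace_fin] at h1
    rw [toFinset_singleton, Finset.card_singleton] at h2
    omega
  obtain ⟨w, hw, hw0⟩ := h
  refine ⟨‖w‖⁻¹ • w, ?_, ?_⟩
  · rw [norm_smul, norm_inv, norm_norm, inv_mul_cancel₀ (norm_ne_zero_iff.2 hw0)]
  · rw [inner_smul_right, Submodule.mem_orthogonal_singleton_iff_inner_right.1 hw, mul_zero]

/-- The plane of two orthonormal vectors has a unit normal. -/
theorem exists_unit_normal {u w : Space} (hu : ‖u‖ = 1) (hw : ‖w‖ = 1) (huw : ⟪u, w⟫_ℝ = 0) :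
    ∃ e : Space, ‖e‖ = 1 ∧ ∀ v, ⟪e, v⟫_ℝ = 0 → v = ⟪u, v⟫_ℝ • u + ⟪w, v⟫_ℝ • w := by
  have hon : Orthonormal ℝ (({0, 1} : Set (Fin 3)).domRestrict (![u, w, 0] : Fin 3 → Space)) := by
    constructor
    · rintro ⟨i, hi⟩
      rcases hi with rfl | rfl
      · exact hu
      · exact hw
    · rintro ⟨i, hi⟩ ⟨j, hj⟩ hij
      rcases hi with rfl | rfl <;> rcases hj with rfl | rfl
      · exact absurd rfl hij
      · exact huw
      · exact (real_inner_comm _ _).trans huw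
      · exact absurd rfl hij
  obtain ⟨b, hb⟩ := hon.exists_orthonormalBasis_extension_of_card_eq (by simp)
  have h0 : b 0 = u := hb 0 (by simp)
  have h1 : b 1 = w := hb 1 (by simp)
  refine ⟨b 2, b.norm_eq_one 2, fun v hv => ?_⟩
  conv_lhs => rw [← b.sum_repr' v]
  rw [Fin.sum_univ_three, h0, h1, hv, zero_smul, add_zero]

/-- The triangle with vertices `x₀ ± A u` and `x₀ + A w` contains a parallelogram with sides
`(A / 2) u` and `(A / 2) w`, hence a disc of radius `A / 4` if `u` and `w` are orthonormal. -/
theorem disc_subset_of_triangle {Ω : Set Space} (hΩ : Convex ℝ Ω) {x₀ u w : Space} {A : ℝ}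
    (hA : 0 < A) (h₁ : x₀ - A • u ∈ Ω) (h₂ : x₀ + A • u ∈ Ω) (h₃ : x₀ + A • w ∈ Ω) {a b : ℝ}
    (ha : |a| ≤ A / 4) (hb : |b| ≤ A / 4) : x₀ + (A / 3) • w + (a • u + b • w) ∈ Ω := by
  obtain ⟨ha1, ha2⟩ := abs_le.1 ha
  obtain ⟨hb1, hb2⟩ := abs_le.1 hb
  have hmem := hΩ.sum_mem (t := Finset.univ) (w := ![(2 / 3 - b / A - a / A) / 2,
    (2 / 3 - b / A + a / A) / 2, 1 / 3 + b / A]) (z := ![x₀ - A • u, x₀ + A • u, x₀ + A • w])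
    (by
      have hb' : b / A ≤ 1 / 4 := by rw [div_le_iff₀ hA]; linarith
      have hb'' : -(1 / 4) ≤ b / A := by rw [le_div_iff₀ hA]; linarith
      have ha' : a / A ≤ 1 / 4 := by rw [div_le_iff₀ hA]; linarith
      have ha'' : -(1 / 4) ≤ a / A := by rw [le_div_iff₀ hA]; linarith
      intro i _
      fin_cases i <;> simp <;> linarith)
    (by simp [Fin.sum_univ_three]; ring)
    (by intro i _; fin_cases i <;> simpa)
  convert hmem using 1
  simp only [Fin.sum_univ_three, Matrix.cons_val_zero, Matrix.cons_val_one, Matrix.cons_val]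
  match_scalars <;> field_simp <;> ring

/-- A cone of height `3 R` over a disc of radius `3 R` contains a ball of radius `R`. -/
theorem ball_subset_of_cone {Ω : Set Space} (hΩ : Convex ℝ Ω) {x₀ e : Space} {R : ℝ}
    (hR : 0 < R) (he : ‖e‖ = 1)
    (hdisc : ∀ x, ⟪e, x - x₀⟫_ℝ = 0 → ‖x - x₀‖ ≤ 3 * R → x ∈ Ω)
    (hapex : x₀ + (3 * R) • e ∈ Ω) : Metric.ball (x₀ + R • e) R ⊆ Ω := by
  intro y hy
  rw [mem_ball_iff_norm] at hy
  set z := y - (x₀ + R • e) with hz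
  set h := ⟪e, z⟫_ℝ with hh
  have hhR : |h| < R := by
    refine lt_of_le_of_lt (abs_real_inner_le_norm e z) ?_
    rwa [he, one_mul]
  obtain ⟨h1, h2⟩ := abs_lt.1 hhR
  set v := z - h • e with hv
  have hev : ⟪e, v⟫_ℝ = 0 := by
    rw [hv, inner_sub_right, inner_smul_right, real_inner_self_eq_norm_sq, he, ← hh]
    ring
  have hvR : ‖v‖ ≤ R := by
    have h3 : ‖z‖ ^ 2 = ‖v‖ ^ 2 + h ^ 2 := by
      have : z = v + h • e := by rw [hv, sub_add_cancel]
      rw [this, norm_add_sq_real, inner_smul_right, real_inner_comm, hev, norm_smul, he]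
      simp
    have h4 : ‖v‖ ^ 2 ≤ ‖z‖ ^ 2 := by nlinarith [sq_nonneg h]
    exact (le_of_sq_le_sq h4 (norm_nonneg z)).trans hy.le
  set μ : ℝ := 2 / 3 - h / (3 * R) with hμ
  have hμ1 : 1 / 3 < μ := by
    have : h / (3 * R) < 1 / 3 := by rw [div_lt_iff₀ (by positivity)]; linarith
    rw [hμ]; linarith
  have hμ2 : μ < 1 := by
    have : -(1 / 3) < h / (3 * R) := by rw [lt_div_iff₀ (by positivity)]; linarith
    rw [hμ]; linarith
  have hμ0 : 0 < μ := by linarith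
  have hbase : x₀ + μ⁻¹ • v ∈ Ω := by
    refine hdisc _ ?_ ?_
    · rw [add_sub_cancel_left, inner_smul_right, hev, mul_zero]
    · rw [add_sub_cancel_left, norm_smul, norm_inv, Real.norm_of_nonneg hμ0.le,
        inv_mul_le_iff₀ hμ0]
      nlinarith
  have hmem := hΩ hbase hapex hμ0.le (sub_nonneg.2 hμ2.le) (by ring)
  convert hmem using 1
  have hy' : y = x₀ + R • e + (v + h • e) := by rw [hv, hz]; abel
  rw [hy', smul_add, smul_smul, mul_inv_cancel₀ hμ0.ne', hμ]
  match_scalars <;> field_simp <;> ring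

section

variable {X : Plane → Space} {Ω : Set Space} {c L D : ℝ}

/-- If `Ω` contains long segments but no large flat discs, then the sections of `Ω` orthogonal to
a long segment are small, and one of them separates two far away points of the surface; but its
parameters fill a bounded set of the plane, which does not separate far away points. -/
theorem exists_disc_subset (hX : Continuous X) (hconv : Convex ℝ Ω) (hΩ : IsOpen Ω)
    (hfr : frontier Ω = range X) (hc : 0 < c) (hlow : ∀ s t, c * ‖s - t‖ ≤ ‖X s - X t‖)
    (hL : 0 < L) (hup : ∀ s t, ‖X s - X t‖ ≤ L * ‖s - t‖ + D) (ρ : ℝ) (hρ : 0 < ρ) :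
    ∃ x₀ e : Space, ‖e‖ = 1 ∧ ∀ x, ⟪e, x - x₀⟫_ℝ = 0 → ‖x - x₀‖ ≤ ρ → x ∈ Ω := by
  by_contra hno
  set A := 4 * ρ with hA
  have hA0 : 0 < A := by positivity
  -- the sections orthogonal to long segments are small
  have hsec : ∀ x₀ u : Space, ‖u‖ = 1 → x₀ - A • u ∈ Ω → x₀ + A • u ∈ Ω →
      ∀ y ∈ Ω, ⟪u, y - x₀⟫_ℝ = 0 → ‖y - x₀‖ < A := by
    intro x₀ u hu h₁ h₂ y hy huy
    by_contra! hlt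
    apply hno
    have hn0 : 0 < ‖y - x₀‖ := hA0.trans_le hlt
    set w := ‖y - x₀‖⁻¹ • (y - x₀) with hw
    have hw1 : ‖w‖ = 1 := by
      rw [hw, norm_smul, norm_inv, norm_norm, inv_mul_cancel₀ hn0.ne']
    have huw : ⟪u, w⟫_ℝ = 0 := by rw [hw, inner_smul_right, huy, mul_zero]
    have hx₀ : x₀ ∈ Ω := by
      have := hconv h₁ h₂ (a := 1 / 2) (b := 1 / 2) (by norm_num) (by norm_num) (by norm_num)
      convert this using 1
      match_scalars <;> ring
    have h₃ : x₀ + A • w ∈ Ω := by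
      have := hconv.add_smul_sub_mem hx₀ hy (t := A / ‖y - x₀‖)
        ⟨by positivity, by rwa [div_le_one hn0]⟩
      convert this using 2
      rw [hw, smul_smul, div_eq_mul_inv]
    obtain ⟨e, he, hev⟩ := exists_unit_normal hu hw1 huw
    refine ⟨x₀ + (A / 3) • w, e, he, fun x hx hxρ => ?_⟩
    set v := x - (x₀ + (A / 3) • w) with hv
    have hx' : x = x₀ + (A / 3) • w + (⟪u, v⟫_ℝ • u + ⟪w, v⟫_ℝ • w) := by
      rw [← hev v hx, hv, add_sub_cancel]
    rw [hx']
    have hρA : A / 4 = ρ := by rw [hA]; ring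
    refine disc_subset_of_triangle hconv hA0 h₁ h₂ h₃ ?_ ?_ <;> rw [hρA]
    · refine (abs_real_inner_le_norm _ _).trans ?_
      rwa [hu, one_mul]
    · refine (abs_real_inner_le_norm _ _).trans ?_
      rwa [hw1, one_mul]
  -- a long segment
  -- the length is chosen such that the parameters of the two ends are out of the disc of radius
  -- `4 A / c`, which contains the parameters of the section through the middle
  obtain ⟨r, hr⟩ : ∃ r : ℝ, r = A + |D| + L * (4 * A / c) + 1 := ⟨_, rfl⟩
  have hr0 : 0 < r := by rw [hr]; positivity
  have hAr : A ≤ r := by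
    have h1 := abs_nonneg D
    have h2 : 0 < L * (4 * A / c) := by positivity
    linarith
  obtain ⟨x₀, u, hu, hseg⟩ : ∃ x₀ u : Space, ‖u‖ = 1 ∧ ∀ a : ℝ, |a| ≤ 2 * r →
      x₀ + a • u ∈ Ω := by
    have hunb : ¬ Bornology.IsBounded Ω := by
      intro hb
      have hb' : Bornology.IsBounded (range X) := by
        rw [← hfr]
        exact hb.closure.subset frontier_subset_closure
      obtain ⟨M, hM⟩ := Metric.isBounded_iff.1 hb'
      have hM0 : 0 ≤ M := dist_nonneg.trans (hM (mem_range_self 0) (mem_range_self 0))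
      have h1 := hlow (EuclideanSpace.single 0 ((M + 1) / c)) 0
      have h2 := hM (mem_range_self (EuclideanSpace.single 0 ((M + 1) / c)))
        (mem_range_self (f := X) 0)
      rw [dist_eq_norm] at h2
      rw [sub_zero, PiLp.norm_single, Real.norm_of_nonneg (by positivity),
        mul_div_cancel₀ _ hc.ne'] at h1
      linarith
    rw [Metric.isBounded_iff] at hunb
    push Not at hunb
    obtain ⟨p, hp, p', hp', hd⟩ := hunb (4 * r)
    rw [dist_eq_norm] at hd
    have hn0 : 0 < ‖p - p'‖ := lt_trans (by positivity) hd
    refine ⟨(1 / 2 : ℝ) • (p + p'), ‖p - p'‖⁻¹ • (p - p'), ?_, fun a ha => ?_⟩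
    · rw [norm_smul, norm_inv, norm_norm, inv_mul_cancel₀ hn0.ne']
    · obtain ⟨ha1, ha2⟩ := abs_le.1 ha
      have hle : |a / ‖p - p'‖| ≤ 1 / 2 := by
        rw [abs_div, abs_of_pos hn0, div_le_iff₀ hn0]
        linarith
      obtain ⟨hl1, hl2⟩ := abs_le.1 hle
      have := hconv hp hp' (a := 1 / 2 + a / ‖p - p'‖) (b := 1 / 2 - a / ‖p - p'‖)
        (by linarith) (by linarith) (by ring)
      convert this using 1
      match_scalars <;> ring
  have hsmem : ∀ a : ℝ, |a| ≤ r → ∀ y ∈ Ω, ⟪u, y - (x₀ + a • u)⟫_ℝ = 0 →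
      ‖y - (x₀ + a • u)‖ < A := by
    intro a ha y hy
    obtain ⟨ha1, ha2⟩ := abs_le.1 ha
    refine hsec _ u hu ?_ ?_ y hy
    · have := hseg (a - A) (abs_le.2 ⟨by linarith, by linarith⟩)
      rwa [sub_smul, ← add_sub_assoc] at this
    · have := hseg (a + A) (abs_le.2 ⟨by linarith, by linarith⟩)
      rwa [add_smul, ← add_assoc] at this
  let F : Plane → ℝ := fun s => ⟪u, X s - x₀⟫_ℝ
  have hF : Continuous F := by fun_prop
  -- the surface reaches both ends of the segment
  have hend : ∀ a : ℝ, |a| ≤ r → ∃ s, F s = a := by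
    intro a ha
    obtain ⟨w, hw, huw⟩ := exists_unit_orthogonal u
    have h1 : x₀ + a • u ∈ Ω := hseg a (ha.trans (by linarith))
    have h2 : x₀ + a • u + A • w ∉ Ω := by
      intro hmem
      have := hsmem a ha _ hmem (by
        rw [add_sub_cancel_left, inner_smul_right, huw, mul_zero])
      rw [add_sub_cancel_left, norm_smul, hw, mul_one, Real.norm_of_nonneg hA0.le] at this
      exact lt_irrefl _ this
    obtain ⟨θ, -, hθ⟩ := exists_mem_frontier_of_notMem h1 h2
    rw [hfr] at hθ
    obtain ⟨s, hs⟩ := hθ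
    refine ⟨s, ?_⟩
    simp only [F]
    rw [hs, add_assoc, add_sub_cancel_left, inner_add_right, inner_smul_right, inner_smul_right,
      inner_smul_right, huw, real_inner_self_eq_norm_sq, hu]
    ring
  -- a point of the surface in the middle section is at most twice as far from `x₀` as the section
  -- of the open set allows, as its midpoint with `x₀` is in `Ω`
  have hsection : ∀ s, F s = 0 → ‖X s - x₀‖ < 2 * A := by
    intro s hs
    by_contra! hlt
    have hx₀ : x₀ ∈ Ω := by
      simpa using hseg 0 (by rw [abs_zero]; linarith)
    have hcl : X s ∈ closure Ω := frontier_subset_closure (by rw [hfr]; exact mem_range_self s)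
    have hmid := hconv.combo_interior_closure_mem_interior (by rwa [hΩ.interior_eq]) hcl
      (a := 1 / 2) (b := 1 / 2) (by norm_num) (by norm_num) (by norm_num)
    rw [hΩ.interior_eq] at hmid
    have heq : (1 / 2 : ℝ) • x₀ + (1 / 2 : ℝ) • X s - (x₀ + (0 : ℝ) • u)
        = (1 / 2 : ℝ) • (X s - x₀) := by
      match_scalars <;> ring
    have := hsmem 0 (by rw [abs_zero]; exact hr0.le) _ hmid (by
      rw [heq, inner_smul_right]; exact mul_eq_zero_of_right _ hs)
    rw [heq, norm_smul] at this
    norm_num at this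
    linarith
  obtain ⟨s₀, hs₀⟩ := hend 0 (by rw [abs_zero]; exact hr0.le)
  obtain ⟨sp, hsp⟩ := hend r (abs_of_pos hr0).le
  obtain ⟨sm, hsm⟩ := hend (-r) (by rw [abs_neg]; exact (abs_of_pos hr0).le)
  have hfar : ∀ s, |F s| = r → s ∈ (Metric.closedBall s₀ (4 * A / c))ᶜ := by
    intro s hs hmem
    rw [mem_closedBall_iff_norm] at hmem
    have h1 : |F s| ≤ ‖X s - X s₀‖ := by
      have : F s = ⟪u, X s - X s₀⟫_ℝ := by
        have h2 : X s - x₀ = (X s - X s₀) + (X s₀ - x₀) := by abel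
        simp only [F] at hs₀ ⊢
        rw [h2, inner_add_right, hs₀, add_zero]
      rw [this]
      refine (abs_real_inner_le_norm _ _).trans ?_
      rw [hu, one_mul]
    have h2 := hup s s₀
    have h3 : L * ‖s - s₀‖ ≤ L * (4 * A / c) := mul_le_mul_of_nonneg_left hmem hL.le
    have h4 := le_abs_self D
    linarith
  have hpre := isPreconnected_compl_closedBall (E := Plane)
    (by rw [← Module.finrank_eq_rank, finrank_euclideanSpace_fin]; norm_num) s₀
    (r := 4 * A / c) (by positivity)
  obtain ⟨s, hs, hs0⟩ := hpre.intermediate_value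
    (hfar sm (by rw [hsm, abs_neg, abs_of_pos hr0])) (hfar sp (by rw [hsp, abs_of_pos hr0]))
    hF.continuousOn (show (0 : ℝ) ∈ Icc (F sm) (F sp) by
      rw [hsm, hsp]; exact ⟨by linarith, hr0.le⟩)
  apply hs
  rw [mem_closedBall_iff_norm, le_div_iff₀ hc, mul_comm]
  refine (hlow s s₀).trans ?_
  have h1 := hsection s hs0
  have h2 := hsection s₀ hs₀
  have h3 : X s - X s₀ = (X s - x₀) - (X s₀ - x₀) := by abel
  rw [h3]
  refine (norm_sub_le _ _).trans ?_
  linarith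

/-- If the ball over a large flat disc in `Ω` is not contained in `Ω`, then the surface has two
nearby points on the two sides of the centre of the disc. Their parameters are close to each
other, so that the surface has to cross the plane of the disc near the centre, which it cannot
do inside the disc. -/
theorem exists_ball_subset (hX : Continuous X) (hconv : Convex ℝ Ω) (hΩ : IsOpen Ω)
    (hfr : frontier Ω = range X) (hc : 0 < c) (hlow : ∀ s t, c * ‖s - t‖ ≤ ‖X s - X t‖)
    (hL : 0 < L) (hup : ∀ s t, ‖X s - X t‖ ≤ L * ‖s - t‖ + D) (R : ℝ) (hR : 0 < R) :
    ∃ x₀ : Space, Metric.ball x₀ R ⊆ Ω := by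
  by_contra! hno
  -- the radius of the disc allows for the diameter of the image of a segment of length `6 R / c`
  obtain ⟨ρ, hρ⟩ : ∃ ρ : ℝ, ρ = 3 * R + L * (6 * R / c) + |D| := ⟨_, rfl⟩
  have hρR : 3 * R ≤ ρ := by
    have : 0 < L * (6 * R / c) := by positivity
    linarith [abs_nonneg D]
  obtain ⟨x₀, e, he, hdisc⟩ := exists_disc_subset hX hconv hΩ hfr hc hlow hL hup ρ (by linarith)
  have hx₀ : x₀ ∈ Ω := hdisc x₀ (by simp) (by rw [sub_self, norm_zero]; linarith)
  have hside : ∀ σ : ℝ, |σ| = 1 → ∃ s, ∃ θ ∈ Icc (0 : ℝ) (3 * R), X s = x₀ + (θ * σ) • e := by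
    intro σ hσ
    have hσe : ‖σ • e‖ = 1 := by rw [norm_smul, he, mul_one, Real.norm_eq_abs, hσ]
    have hσ0 : σ ≠ 0 := by rintro rfl; simp at hσ
    have h1 : x₀ + (3 * R) • (σ • e) ∉ Ω := by
      intro h
      refine hno _ (ball_subset_of_cone hconv hR hσe (fun x hx hxn => ?_) h)
      refine hdisc x ?_ (hxn.trans hρR)
      rw [inner_smul_left] at hx
      simpa [hσ0] using hx
    obtain ⟨θ, hθ, hfrθ⟩ := exists_mem_frontier_of_notMem hx₀ h1
    rw [hfr] at hfrθ
    obtain ⟨s, hs⟩ := hfrθ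
    refine ⟨s, θ * (3 * R), ⟨by have := hθ.1; positivity, ?_⟩, ?_⟩
    · have := hθ.2
      nlinarith
    · rw [hs, smul_smul, smul_smul, mul_assoc]
  obtain ⟨s₁, θ₁, hθ₁, hs₁⟩ := hside 1 (by simp)
  obtain ⟨s₂, θ₂, hθ₂, hs₂⟩ := hside (-1) (by simp)
  have hclose : ‖s₂ - s₁‖ ≤ 6 * R / c := by
    rw [le_div_iff₀ hc, mul_comm]
    refine (hlow s₂ s₁).trans ?_
    have : X s₂ - X s₁ = (-(θ₁ + θ₂)) • e := by
      rw [hs₁, hs₂]; match_scalars <;> ring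
    rw [this, norm_smul, he, mul_one, norm_neg, Real.norm_of_nonneg (add_nonneg hθ₁.1 hθ₂.1)]
    linarith [hθ₁.2, hθ₂.2]
  let F : Plane → ℝ := fun s => ⟪e, X s - x₀⟫_ℝ
  have hF : Continuous F := by fun_prop
  have hF₁ : F s₁ = θ₁ := by
    simp only [F]
    rw [hs₁, add_sub_cancel_left, inner_smul_right, real_inner_self_eq_norm_sq, he]
    ring
  have hF₂ : F s₂ = -θ₂ := by
    simp only [F]
    rw [hs₂, add_sub_cancel_left, inner_smul_right, real_inner_self_eq_norm_sq, he]
    ring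
  obtain ⟨s, hs, hs0⟩ := (convex_segment s₁ s₂).isPreconnected.intermediate_value
    (right_mem_segment ℝ s₁ s₂) (left_mem_segment ℝ s₁ s₂) hF.continuousOn
    (show (0 : ℝ) ∈ Icc (F s₂) (F s₁) by
      rw [hF₁, hF₂]; exact ⟨neg_nonpos.2 hθ₂.1, hθ₁.1⟩)
  have hsn : X s ∉ Ω := by
    have : X s ∈ frontier Ω := by rw [hfr]; exact mem_range_self s
    exact fun h => (hΩ.inter_frontier_eq ▸ mem_inter h this : X s ∈ (∅ : Set Space))
  apply hsn
  refine hdisc _ hs0 ?_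
  have h1 : ‖s - s₁‖ ≤ ‖s₂ - s₁‖ := norm_sub_le_of_mem_segment hs
  have h2 := hup s s₁
  have h3 : L * ‖s - s₁‖ ≤ L * (6 * R / c) := mul_le_mul_of_nonneg_left (h1.trans hclose) hL.le
  have h4 : ‖X s₁ - x₀‖ ≤ 3 * R := by
    rw [hs₁, add_sub_cancel_left, norm_smul, he, mul_one, mul_one, Real.norm_of_nonneg hθ₁.1]
    exact hθ₁.2
  have h5 : X s - x₀ = (X s - X s₁) + (X s₁ - x₀) := by abel
  rw [h5]
  refine (norm_add_le _ _).trans ?_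
  linarith [le_abs_self D]

end

end LargeBalls

/-! ### The singular set -/

section SingularSet

variable {X : Plane → Space} {S : Set Space}

theorem IsC1Curve.isCompact {C : Set Space} (h : IsC1Curve C) : IsCompact C := by
  obtain ⟨γ, hγ, rfl⟩ := h
  exact isCompact_Icc.image_of_continuousOn hγ.continuousOn

theorem IsC1Curve.dimH_le {C : Set Space} (h : IsC1Curve C) : dimH C ≤ 1 := by
  obtain ⟨γ, hγ, rfl⟩ := h
  refine (hγ.dimH_image_le (convex_Icc 0 1) subset_rfl).trans ?_
  exact (dimH_mono (subset_univ _)).trans Real.dimH_univ.le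

theorem IsSingularSet.isCompact (h : IsSingularSet X S) : IsCompact S := by
  obtain ⟨curves, points, hc, hp, hC, -, rfl⟩ := h
  exact (hc.isCompact_sUnion fun C hCm => (hC C hCm).1.isCompact).union hp.isCompact

theorem IsSingularSet.dimH_le (h : IsSingularSet X S) : dimH S ≤ 1 := by
  obtain ⟨curves, points, hc, hp, hC, -, rfl⟩ := h
  rw [dimH_union, dimH_finite hp, dimH_sUnion hc.countable]
  exact max_le (iSup₂_le fun C hCm => (hC C hCm).1.dimH_le) zero_le_one

theorem volume_eq_zero_of_dimH_le_one {N : Set Plane} (h : dimH N ≤ 1) : volume N = 0 := by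
  have hac : (volume : Measure Plane) ≪ μH[((2 : NNReal) : ℝ)] := by
    have h2 : ((2 : NNReal) : ℝ) = (Module.finrank ℝ Plane : ℝ) := by simp
    rw [h2]
    exact Measure.absolutelyContinuous_isAddHaarMeasure _ _
  exact measure_zero_of_dimH_lt hac (lt_of_le_of_lt h (by norm_num))

/-- The parameters of the singular set form a null set, because the inverse of `X` is
Lipschitz. -/
theorem volume_preimage_singularSet (h : IsSingularSet X S) {c : ℝ} (hc : 0 < c)
    (hlow : ∀ s t, c * ‖s - t‖ ≤ ‖X s - X t‖) : volume (X ⁻¹' S) = 0 := by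
  have hanti : AntilipschitzWith (Real.toNNReal c)⁻¹ X := by
    refine AntilipschitzWith.of_le_mul_dist fun s t => ?_
    rw [dist_eq_norm, dist_eq_norm, NNReal.coe_inv, Real.coe_toNNReal _ hc.le,
      le_inv_mul_iff₀ hc]
    exact hlow s t
  exact volume_eq_zero_of_dimH_le_one ((hanti.dimH_preimage_le S).trans h.dimH_le)

end SingularSet

/-! ### The metric tensor -/

section Metric

variable {X : Plane → Space}

theorem plane_eq_sum (v : Plane) : v = v 0 • EuclideanSpace.single 0 1
    + v 1 • EuclideanSpace.single 1 1 := by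
  ext i
  fin_cases i <;> simp

theorem fderiv_apply_eq_sum (s v : Plane) :
    fderiv ℝ X s v = v 0 • tangent X 0 s + v 1 • tangent X 1 s := by
  conv_lhs => rw [plane_eq_sum v]
  rw [map_add, map_smul, map_smul, tangent, tangent]

theorem metricTensor_quadratic (s v : Plane) :
    ∑ i, ∑ j, metricTensor X s i j * v i * v j = ‖fderiv ℝ X s v‖ ^ 2 := by
  rw [fderiv_apply_eq_sum, ← real_inner_self_eq_norm_sq]
  simp only [Fin.sum_univ_two, metricTensor, Matrix.of_apply, inner_add_left, inner_add_right,
    inner_smul_left, inner_smul_right, conj_trivial]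
  ring

theorem det_metricTensor (s : Plane) : (metricTensor X s).det =
    ‖tangent X 0 s‖ ^ 2 * ‖tangent X 1 s‖ ^ 2 - ⟪tangent X 0 s, tangent X 1 s⟫_ℝ ^ 2 := by
  rw [Matrix.det_fin_two]
  simp only [metricTensor, Matrix.of_apply, real_inner_self_eq_norm_sq,
    real_inner_comm (tangent X 0 s) (tangent X 1 s)]
  ring

theorem det_metricTensor_pos {s : Plane} {c₁ : ℝ} (hc₁ : 0 < c₁)
    (h : ∀ v : Plane, c₁ * ‖v‖ ^ 2 ≤ ∑ i, ∑ j, metricTensor X s i j * v i * v j) :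
    0 < (metricTensor X s).det := by
  rw [det_metricTensor]
  set t₀ := tangent X 0 s
  set t₁ := tangent X 1 s
  have hlow : ∀ a b : ℝ, (a ≠ 0 ∨ b ≠ 0) → 0 < ‖a • t₀ + b • t₁‖ ^ 2 := by
    intro a b hab
    have h1 := h (a • EuclideanSpace.single 0 1 + b • EuclideanSpace.single 1 1)
    have hv : ‖a • (EuclideanSpace.single 0 1 : Plane) + b • EuclideanSpace.single 1 1‖ ^ 2
        = a ^ 2 + b ^ 2 := by
      simp [EuclideanSpace.norm_sq_eq]
    rw [metricTensor_quadratic, fderiv_apply_eq_sum, hv] at h1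
    simp only [PiLp.add_apply, PiLp.smul_apply, PiLp.single_apply] at h1
    simp at h1
    have h2 : 0 < c₁ * (a ^ 2 + b ^ 2) := by
      rcases hab with h0 | h0 <;> positivity
    exact h2.trans_le h1
  have h1 := hlow 0 1 (by simp)
  -- up to a factor, the component of `t₀` orthogonal to `t₁`
  have h2 := hlow (‖t₁‖ ^ 2) (-⟪t₀, t₁⟫_ℝ) (Or.inl (by simpa using h1.ne'))
  rw [zero_smul, zero_add, one_smul] at h1
  rw [← real_inner_self_eq_norm_sq] at h2
  simp only [inner_add_left, inner_add_right, inner_smul_left, inner_smul_right, conj_trivial,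
    real_inner_self_eq_norm_sq, real_inner_comm t₀ t₁] at h2
  have h3 : 0 < ‖t₁‖ ^ 2 * (‖t₀‖ ^ 2 * ‖t₁‖ ^ 2 - ⟪t₀, t₁⟫_ℝ ^ 2) := by
    linarith
  exact pos_of_mul_pos_right h3 h1.le

end Metric

/-! ### Determinants of monotone perturbations -/

section Jacobian

/-- The orthogonal projection of the space onto the plane of its first two coordinates. -/
def planeProj : Space →L[ℝ] Plane :=
  LinearMap.toContinuousLinearMap
    { toFun := fun y => !₂[y 0, y 1]
      map_add' := by intro x y; ext i; fin_cases i <;> simp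
      map_smul' := by intro x y; ext i; fin_cases i <;> simp }

/-- The last coordinate of the space. -/
def heightProj : Space →L[ℝ] ℝ := EuclideanSpace.proj 2

/-- The linear map of the space with `e₁, e₂ ↦ T e₁, T e₂` and `e₃ ↦ ν`. -/
def adjoinColumn (T : Plane →L[ℝ] Space) (ν : Space) : Space →L[ℝ] Space :=
  T ∘L planeProj + heightProj.smulRight ν

theorem planeProj_single :
    planeProj (EuclideanSpace.single 0 1) = EuclideanSpace.single 0 1 ∧
    planeProj (EuclideanSpace.single 1 1) = EuclideanSpace.single 1 1 ∧
    planeProj (EuclideanSpace.single 2 1) = 0 := by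
  refine ⟨?_, ?_, ?_⟩ <;> ext i <;> fin_cases i <;> simp [planeProj]

theorem det_mul_det_eq_gram (A B : Space →L[ℝ] Space) :
    A.det * B.det = (Matrix.of fun i j : Fin 3 =>
      ⟪A (EuclideanSpace.single i 1), B (EuclideanSpace.single j 1)⟫_ℝ).det := by
  set b := EuclideanSpace.basisFun (Fin 3) ℝ
  have hdet : ∀ C : Space →L[ℝ] Space,
      C.det = (LinearMap.toMatrix b.toBasis b.toBasis (C : Space →ₗ[ℝ] Space)).det :=
    fun C => (LinearMap.det_toMatrix b.toBasis _).symm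
  rw [hdet A, hdet B, ← Matrix.det_transpose, ← Matrix.det_mul]
  congr 1
  ext i j
  simp [Matrix.mul_apply, LinearMap.toMatrix_apply, b, PiLp.inner_apply, mul_comm]

/-- The Gram determinant does not decrease when a form with nonnegative diagonal is added. The
antisymmetric part of this form only increases the determinant. -/
theorem det_le_det_add {a b d p q r s : ℝ} (ha : 0 ≤ a) (hd : 0 ≤ d) (hb : b ^ 2 ≤ a * d)
    (h : ∀ x y : ℝ, 0 ≤ p * x ^ 2 + (q + r) * x * y + s * y ^ 2) :
    a * d - b ^ 2 ≤ (a + p) * (d + s) - (b + q) * (b + r) := by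
  have hp : 0 ≤ p := by simpa using h 1 0
  have hs : 0 ≤ s := by simpa using h 0 1
  have hdisc : (q + r) ^ 2 ≤ 4 * (p * s) := by
    rcases hp.eq_or_lt with hp0 | hp0
    · have hqr : q + r = 0 := by
        by_contra hne
        have := h (-(s + 1) / (q + r)) 1
        have hx : (q + r) * (-(s + 1) / (q + r)) = -(s + 1) := mul_div_cancel₀ _ hne
        rw [← hp0, hx] at this
        linarith
      rw [hqr, ← hp0]; norm_num
    · have := h (-(q + r)) (2 * p)
      nlinarith
  -- the mixed term, by the inequality of the arithmetic and geometric means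
  have hmix : 0 ≤ a * s + p * d - b * (q + r) := by
    have h1 : (b * (q + r)) ^ 2 ≤ (a * s + p * d) ^ 2 := by
      have h2 : (b * (q + r)) ^ 2 ≤ (a * d) * (4 * (p * s)) := by
        rw [mul_pow]
        exact mul_le_mul hb hdisc (sq_nonneg _) (by positivity)
      nlinarith [sq_nonneg (a * s - p * d)]
    linarith [abs_le_of_sq_le_sq h1 (by positivity), le_abs_self (b * (q + r))]
  nlinarith [sq_nonneg (q - r)]

/-- The square root of the Gram determinant of `T` does not exceed the volume spanned by the
columns of `T + t N` and the unit normal `ν` of the range of `T`, if `N` is monotone relative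
to `T`. -/
theorem gram_le_abs_det (T N : Plane →L[ℝ] Space) (ν : Space) (hν : ‖ν‖ = 1)
    (hT : ∀ v, ⟪T v, ν⟫_ℝ = 0) (hTN : ∀ v, 0 ≤ ⟪T v, N v⟫_ℝ) {t : ℝ} (ht : 0 ≤ t) :
    √((Matrix.of fun i j : Fin 2 =>
      ⟪T (EuclideanSpace.single i 1), T (EuclideanSpace.single j 1)⟫_ℝ).det)
      ≤ |(adjoinColumn (T + t • N) ν).det| := by
  obtain ⟨h0, h1, h2⟩ := planeProj_single
  set e₀ : Plane := EuclideanSpace.single 0 1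
  set e₁ : Plane := EuclideanSpace.single 1 1
  set G := (Matrix.of fun i j : Fin 2 =>
      ⟪T (EuclideanSpace.single i 1), T (EuclideanSpace.single j 1)⟫_ℝ).det with hG
  have hG' : G = ⟪T e₀, T e₀⟫_ℝ * ⟪T e₁, T e₁⟫_ℝ - ⟪T e₀, T e₁⟫_ℝ ^ 2 := by
    rw [hG, Matrix.det_fin_two]
    simp only [Matrix.of_apply]
    rw [real_inner_comm (T e₀) (T e₁)]
    ring
  have hcs : ⟪T e₀, T e₁⟫_ℝ ^ 2 ≤ ⟪T e₀, T e₀⟫_ℝ * ⟪T e₁, T e₁⟫_ℝ := by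
    rw [sq]
    exact real_inner_mul_inner_self_le _ _
  have hG0 : 0 ≤ G := by rw [hG']; linarith
  set A := adjoinColumn T ν
  set B := adjoinColumn (T + t • N) ν
  have hA : ∀ y, A y = T (planeProj y) + y 2 • ν := fun y => rfl
  have hB : ∀ y, B y = T (planeProj y) + t • N (planeProj y) + y 2 • ν := fun y => rfl
  have hνν : ⟪ν, ν⟫_ℝ = 1 := by rw [real_inner_self_eq_norm_sq, hν]; norm_num
  have hT' : ∀ v, ⟪ν, T v⟫_ℝ = 0 := fun v => by rw [real_inner_comm, hT]
  have hAA : A.det * A.det = G := by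
    rw [det_mul_det_eq_gram, Matrix.det_fin_three, hG']
    simp only [Matrix.of_apply, hA, h0, h1, h2]
    simp [hT, hT', hν]
    rw [real_inner_comm (T e₀) (T e₁)]
    ring
  -- comparing `A.det * B.det` with `A.det ^ 2`, the components of `N` along `ν` drop out
  have hAB : G ≤ A.det * B.det := by
    rw [det_mul_det_eq_gram, Matrix.det_fin_three, hG']
    simp only [Matrix.of_apply, hA, hB, h0, h1, h2]
    simp only [PiLp.single_apply, inner_add_left, inner_add_right, inner_smul_left,
      inner_smul_right, hνν, hT, hT', map_zero]
    simp
    have := det_le_det_add (a := ⟪T e₀, T e₀⟫_ℝ) (d := ⟪T e₁, T e₁⟫_ℝ) (b := ⟪T e₀, T e₁⟫_ℝ)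
      (p := t * ⟪T e₀, N e₀⟫_ℝ) (q := t * ⟪T e₀, N e₁⟫_ℝ) (r := t * ⟪T e₁, N e₀⟫_ℝ)
      (s := t * ⟪T e₁, N e₁⟫_ℝ) real_inner_self_nonneg real_inner_self_nonneg hcs (by
        intro x y
        have h3 := mul_nonneg ht (hTN (x • e₀ + y • e₁))
        simp only [map_add, map_smul, inner_add_left, inner_add_right, inner_smul_left,
          inner_smul_right, conj_trivial] at h3
        linarith)
    rw [real_inner_comm (T e₀) (T e₁)]
    simp only [real_inner_self_eq_norm_sq] at this ⊢
    linarith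
  have h3 : √G = |A.det| := by rw [← hAA, Real.sqrt_mul_self_eq_abs]
  rw [h3]
  have h4 : |A.det| * |A.det| ≤ |A.det| * |B.det| := by
    rw [← abs_mul, ← abs_mul, hAA, abs_of_nonneg hG0]
    exact hAB.trans (le_abs_self _)
  rcases (abs_nonneg A.det).eq_or_lt with h5 | h5
  · rw [← h5]; exact abs_nonneg _
  · exact le_of_mul_le_mul_left h4 h5

end Jacobian

/-! ### The unit normal of the boundary of a convex region -/

section Normal

variable {X : Plane → Space} {s : Plane}

/-- The vector product of the coordinate tangent vectors. -/
def crossTangent (X : Plane → Space) (s : Plane) : Space :=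
  WithLp.toLp 2 (crossProduct (WithLp.ofLp (tangent X 0 s)) (WithLp.ofLp (tangent X 1 s)))

theorem unitNormal_eq (X : Plane → Space) (s : Plane) :
    unitNormal X s = ‖crossTangent X s‖⁻¹ • crossTangent X s := rfl

theorem norm_sq_crossTangent (X : Plane → Space) (s : Plane) :
    ‖crossTangent X s‖ ^ 2 = (metricTensor X s).det := by
  rw [det_metricTensor]
  simp only [crossTangent, cross_apply, EuclideanSpace.norm_sq_eq, PiLp.inner_apply,
    Fin.sum_univ_three, Real.norm_eq_abs, sq_abs]
  simp
  ring

theorem inner_tangent_crossTangent (X : Plane → Space) (s : Plane) (i : Fin 2) :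
    ⟪tangent X i s, crossTangent X s⟫_ℝ = 0 := by
  fin_cases i <;>
    simp [crossTangent, cross_apply, PiLp.inner_apply, Fin.sum_univ_three] <;> ring

theorem crossTangent_ne_zero (h : 0 < (metricTensor X s).det) : crossTangent X s ≠ 0 := by
  intro h0
  rw [← norm_sq_crossTangent, h0, norm_zero] at h
  norm_num at h

theorem norm_unitNormal (h : 0 < (metricTensor X s).det) : ‖unitNormal X s‖ = 1 := by
  rw [unitNormal_eq, norm_smul, norm_inv, norm_norm,
    inv_mul_cancel₀ (norm_ne_zero_iff.2 (crossTangent_ne_zero h))]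

theorem inner_fderiv_unitNormal (X : Plane → Space) (s v : Plane) :
    ⟪fderiv ℝ X s v, unitNormal X s⟫_ℝ = 0 := by
  rw [fderiv_apply_eq_sum, unitNormal_eq]
  simp [inner_add_left, inner_smul_left, inner_smul_right, inner_tangent_crossTangent]

/-- A unit vector orthogonal to the tangent plane is the unit normal up to its sign. -/
theorem eq_or_eq_neg_unitNormal (h : 0 < (metricTensor X s).det) {a : Space} (ha : ‖a‖ = 1)
    (hat : ∀ i, ⟪a, tangent X i s⟫_ℝ = 0) : a = unitNormal X s ∨ a = -unitNormal X s := by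
  set n := unitNormal X s with hn
  set c := crossTangent X s with hc
  have hlag : ‖c‖ ^ 2 * ‖a‖ ^ 2 - ⟪c, a⟫_ℝ ^ 2 = ‖⟪tangent X 0 s, a⟫_ℝ • tangent X 1 s
      - ⟪tangent X 1 s, a⟫_ℝ • tangent X 0 s‖ ^ 2 := by
    simp only [hc, crossTangent, cross_apply, EuclideanSpace.norm_sq_eq, PiLp.inner_apply,
      Fin.sum_univ_three, Real.norm_eq_abs, sq_abs]
    simp
    ring
  rw [real_inner_comm a (tangent X 0 s), hat, real_inner_comm a (tangent X 1 s), hat, ha] at hlag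
  simp only [zero_smul, sub_zero, norm_zero] at hlag
  have hc0 : 0 < ‖c‖ := norm_pos_iff.2 (crossTangent_ne_zero h)
  have hna : ⟪n, a⟫_ℝ ^ 2 = 1 := by
    rw [hn, unitNormal_eq, inner_smul_left, conj_trivial, mul_pow, ← hc]
    field_simp
    linarith
  have hexp : ∀ σ : ℝ, ‖a - σ • n‖ ^ 2 = 1 - 2 * σ * ⟪n, a⟫_ℝ + σ ^ 2 := by
    intro σ
    rw [norm_sub_sq_real, inner_smul_right, norm_smul, hn, norm_unitNormal h, ← hn, ha,
      Real.norm_eq_abs, mul_one, sq_abs, real_inner_comm]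
    ring
  rcases (sq_eq_sq_iff_eq_or_eq_neg (b := (1 : ℝ))).1 (by rw [hna, one_pow]) with h1 | h1
  · left
    have := hexp 1
    rw [h1] at this
    norm_num at this
    exact sub_eq_zero.1 this
  · right
    have := hexp (-1)
    rw [h1] at this
    norm_num at this
    exact eq_neg_of_add_eq_zero_left this

theorem differentiableAt_unitNormal (hX : ContDiffAt ℝ 2 X s)
    (h : 0 < (metricTensor X s).det) : DifferentiableAt ℝ (unitNormal X) s := by
  have ht : ∀ i, DifferentiableAt ℝ (tangent X i) s := by
    intro i
    have h1 : DifferentiableAt ℝ (fderiv ℝ X) s :=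
      (hX.fderiv_right (m := 1) (by norm_num)).differentiableAt one_ne_zero
    exact h1.clm_apply (differentiableAt_const _)
  have ht' : ∀ i k, DifferentiableAt ℝ (fun s => tangent X i s k) s := by
    intro i k
    exact (EuclideanSpace.proj k : Space →L[ℝ] ℝ).differentiableAt.comp s (ht i)
  have hc : DifferentiableAt ℝ (crossTangent X) s := by
    rw [differentiableAt_euclidean]
    intro k
    simp only [crossTangent, cross_apply]
    fin_cases k <;> simp <;> fun_prop
  exact ((hc.norm ℝ (crossTangent_ne_zero h)).inv
    (norm_ne_zero_iff.2 (crossTangent_ne_zero h))).smul hc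

/-- The unit normal which points away from the side of the point `z₀`; for a point `z₀` of the
convex region this is the outer normal. -/
def outerNormal (X : Plane → Space) (z₀ : Space) (s : Plane) : Space :=
  open Classical in
  if ⟪unitNormal X s, z₀ - X s⟫_ℝ < 0 then unitNormal X s else -unitNormal X s

theorem outerNormal_eq_or (X : Plane → Space) (z₀ : Space) (s : Plane) :
    outerNormal X z₀ s = unitNormal X s ∨ outerNormal X z₀ s = -unitNormal X s := by
  unfold outerNormal
  split_ifs <;> simp

theorem norm_outerNormal (z₀ : Space) (h : 0 < (metricTensor X s).det) :
    ‖outerNormal X z₀ s‖ = 1 := by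
  rcases outerNormal_eq_or X z₀ s with h1 | h1 <;> rw [h1]
  · exact norm_unitNormal h
  · rw [norm_neg, norm_unitNormal h]

theorem inner_fderiv_outerNormal (X : Plane → Space) (z₀ : Space) (s v : Plane) :
    ⟪fderiv ℝ X s v, outerNormal X z₀ s⟫_ℝ = 0 := by
  rcases outerNormal_eq_or X z₀ s with h1 | h1 <;> rw [h1]
  · exact inner_fderiv_unitNormal X s v
  · rw [inner_neg_right, inner_fderiv_unitNormal, neg_zero]

variable {Ω : Set Space} {z₀ : Space}

/-- The convex set lies on the inner side of each tangent plane of its boundary surface, because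
a supporting plane at a regular point is the tangent plane. -/
theorem inner_outerNormal_neg (hconv : Convex ℝ Ω) (hΩ : IsOpen Ω) (hfr : frontier Ω = range X)
    (hz₀ : z₀ ∈ Ω) (hX : DifferentiableAt ℝ X s) (h : 0 < (metricTensor X s).det) :
    ∀ z ∈ Ω, ⟪outerNormal X z₀ s, z - X s⟫_ℝ < 0 := by
  have hmem : ∀ t, X t ∈ frontier Ω := fun t => by rw [hfr]; exact mem_range_self t
  have hs : X s ∉ Ω := fun hs => by
    have : X s ∈ (∅ : Set Space) := hΩ.inter_frontier_eq ▸ mem_inter hs (hmem s)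
    exact this
  obtain ⟨f, hf⟩ := geometric_hahn_banach_open_point hconv hΩ hs
  set a := (InnerProductSpace.toDual ℝ Space).symm f with ha
  have hfa : ∀ z, f z = ⟪a, z⟫_ℝ := fun z => by
    rw [ha, InnerProductSpace.toDual_symm_apply]
  have ha0 : a ≠ 0 := by
    intro h0
    have := hf z₀ hz₀
    rw [hfa, hfa, h0, inner_zero_left, inner_zero_left] at this
    exact lt_irrefl _ this
  have hcl : ∀ t, f (X t) ≤ f (X s) := by
    intro t
    have hcl' : closure Ω ⊆ {z | f z ≤ f (X s)} :=
      closure_minimal (fun z hz => (hf z hz).le)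
        (isClosed_le f.continuous continuous_const)
    exact hcl' (frontier_subset_closure (hmem t))
  have hmax : IsLocalMax (fun t => f (X t)) s := Filter.Eventually.of_forall hcl
  have hcrit : ∀ v, ⟪a, fderiv ℝ X s v⟫_ℝ = 0 := by
    intro v
    have h1 := hmax.hasFDerivAt_eq_zero (f.hasFDerivAt.comp s hX.hasFDerivAt)
    have h2 := DFunLike.congr_fun h1 v
    rw [← hfa]
    exact h2
  have hapos : 0 < ‖a‖ := norm_pos_iff.2 ha0
  have hside : ∀ z ∈ Ω, ⟪‖a‖⁻¹ • a, z - X s⟫_ℝ < 0 := by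
    intro z hz
    have := hf z hz
    rw [hfa, hfa] at this
    rw [inner_smul_left, inner_sub_right, conj_trivial]
    exact mul_neg_of_pos_of_neg (inv_pos.2 hapos) (sub_neg.2 this)
  rcases eq_or_eq_neg_unitNormal h (a := ‖a‖⁻¹ • a)
    (by rw [norm_smul, norm_inv, norm_norm, inv_mul_cancel₀ hapos.ne'])
    (fun i => by rw [inner_smul_left, tangent, hcrit, mul_zero]) with h1 | h1
  · rw [h1] at hside
    rw [outerNormal, if_pos (hside z₀ hz₀)]
    exact hside
  · rw [h1] at hside
    have h2 := hside z₀ hz₀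
    rw [inner_neg_left] at h2
    rw [outerNormal, if_neg (by linarith)]
    exact hside

theorem inner_outerNormal_nonpos (hconv : Convex ℝ Ω) (hΩ : IsOpen Ω)
    (hfr : frontier Ω = range X) (hz₀ : z₀ ∈ Ω) (hX : DifferentiableAt ℝ X s)
    (h : 0 < (metricTensor X s).det) :
    ∀ z ∈ closure Ω, ⟪outerNormal X z₀ s, z - X s⟫_ℝ ≤ 0 := by
  have hcl : closure Ω ⊆ {z | ⟪outerNormal X z₀ s, z - X s⟫_ℝ ≤ 0} :=
    closure_minimal (fun z hz => (inner_outerNormal_neg hconv hΩ hfr hz₀ hX h z hz).le)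
      (isClosed_le (by fun_prop) continuous_const)
  exact hcl

variable {U : Set Plane}

theorem differentiableAt_outerNormal (hconv : Convex ℝ Ω) (hΩ : IsOpen Ω)
    (hfr : frontier Ω = range X) (hz₀ : z₀ ∈ Ω) (hX : ContDiffAt ℝ 2 X s)
    (h : 0 < (metricTensor X s).det) : DifferentiableAt ℝ (outerNormal X z₀) s := by
  have hXd : DifferentiableAt ℝ X s := hX.differentiableAt two_ne_zero
  have hn := differentiableAt_unitNormal hX h
  have hcont : ContinuousAt (fun s => ⟪unitNormal X s, z₀ - X s⟫_ℝ) s :=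
    hn.continuousAt.inner (continuousAt_const.sub hXd.continuousAt)
  have hneg := inner_outerNormal_neg hconv hΩ hfr hz₀ hXd h z₀ hz₀
  by_cases hlt : ⟪unitNormal X s, z₀ - X s⟫_ℝ < 0
  · refine hn.congr_of_eventuallyEq ?_
    filter_upwards [hcont.eventually_lt_const hlt] with t ht
    rw [outerNormal, if_pos ht]
  · rw [outerNormal, if_neg hlt, inner_neg_left, neg_neg_iff_pos] at hneg
    refine hn.neg.congr_of_eventuallyEq ?_
    filter_upwards [hcont.eventually_const_lt hneg] with t ht
    rw [outerNormal, if_neg ht.not_gt]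
    rfl

/-- The normals of a convex surface form a monotone vector field. -/
theorem inner_fderiv_fderiv_outerNormal_nonneg (hconv : Convex ℝ Ω) (hΩ : IsOpen Ω)
    (hfr : frontier Ω = range X) (hz₀ : z₀ ∈ Ω) (hU : IsOpen U)
    (hX : ∀ s ∈ U, ContDiffAt ℝ 2 X s) (h : ∀ s ∈ U, 0 < (metricTensor X s).det)
    (hs : s ∈ U) (v : Plane) :
    0 ≤ ⟪fderiv ℝ X s v, fderiv ℝ (outerNormal X z₀) s v⟫_ℝ := by
  have hcl : ∀ t, X t ∈ closure Ω := fun t =>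
    frontier_subset_closure (by rw [hfr]; exact mem_range_self t)
  have hd : ∀ s ∈ U, DifferentiableAt ℝ X s := fun s hs => (hX s hs).differentiableAt two_ne_zero
  have h1 := ((hd s hs).hasFDerivAt.hasLineDerivAt v).tendsto_slope_zero
  have h2 := ((differentiableAt_outerNormal hconv hΩ hfr hz₀ (hX s hs)
    (h s hs)).hasFDerivAt.hasLineDerivAt v).tendsto_slope_zero
  refine ge_of_tendsto (h1.inner h2) ?_
  have hev : ∀ᶠ τ in 𝓝[≠] (0 : ℝ), s + τ • v ∈ U := by
    have hc : ContinuousAt (fun τ : ℝ => s + τ • v) 0 := by fun_prop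
    exact (hc.eventually_mem (hU.mem_nhds (by simpa using hs))).filter_mono nhdsWithin_le_nhds
  filter_upwards [hev] with τ hτ
  have h3 := inner_outerNormal_nonpos hconv hΩ hfr hz₀ (hd s hs) (h s hs) _ (hcl (s + τ • v))
  have h4 := inner_outerNormal_nonpos hconv hΩ hfr hz₀ (hd _ hτ) (h _ hτ) _ (hcl s)
  rw [inner_smul_left, inner_smul_right, conj_trivial, ← mul_assoc]
  refine mul_nonneg (mul_self_nonneg _) ?_
  rw [← neg_sub (X (s + τ • v)) (X s), inner_neg_right] at h4
  rw [inner_sub_right, real_inner_comm, real_inner_comm (outerNormal X z₀ s)]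
  linarith

/-- The normal coordinates `(s, t) ↦ X(s) + t ν(s)`, with the pair `(s, t)` of a parameter and a
height encoded as a point `y` of the space, so that the domain and the range have the same
dimension. -/
def normalMap (X : Plane → Space) (z₀ : Space) (y : Space) : Space :=
  X (planeProj y) + y 2 • outerNormal X z₀ (planeProj y)

theorem hasFDerivAt_normalMap {y : Space} (hX : DifferentiableAt ℝ X (planeProj y))
    (hν : DifferentiableAt ℝ (outerNormal X z₀) (planeProj y)) :
    HasFDerivAt (normalMap X z₀)
      (adjoinColumn (fderiv ℝ X (planeProj y) + y 2 • fderiv ℝ (outerNormal X z₀) (planeProj y))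
        (outerNormal X z₀ (planeProj y))) y := by
  have h1 := hX.hasFDerivAt.comp y planeProj.hasFDerivAt
  have h2 := hν.hasFDerivAt.comp y planeProj.hasFDerivAt
  have h3 := (heightProj.hasFDerivAt (x := y)).smul h2
  refine (h1.add h3).congr_fderiv ?_
  ext1 v
  simp only [adjoinColumn, ContinuousLinearMap.comp_apply, add_apply, smul_apply,
    ContinuousLinearMap.smulRight_apply, Function.comp_apply]
  rw [add_assoc]
  rfl

/-- If `z` is behind the plane through `x` with the unit normal `ν`, then `x` is nearer to
`x + t ν` than `z`, with the gain of Pythagoras. -/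
theorem norm_sq_add_le_of_inner_nonpos {x z ν : Space} {t : ℝ} (ht : 0 ≤ t)
    (h : ⟪ν, z - x⟫_ℝ ≤ 0) : ‖t • ν‖ ^ 2 + ‖z - x‖ ^ 2 ≤ ‖x + t • ν - z‖ ^ 2 := by
  have h1 : x + t • ν - z = t • ν - (z - x) := by abel
  rw [h1, norm_sub_sq_real (t • ν), inner_smul_left, conj_trivial]
  nlinarith [mul_nonneg ht (neg_nonneg.2 h)]

/-- The half-lines along the outer normals are disjoint: a common point of two of them would have
two nearest points in the convex set. -/
theorem injOn_normalMap (hconv : Convex ℝ Ω) (hΩ : IsOpen Ω) (hfr : frontier Ω = range X)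
    (hinj : Function.Injective X) (hz₀ : z₀ ∈ Ω) (hX : ∀ s ∈ U, ContDiffAt ℝ 2 X s)
    (h : ∀ s ∈ U, 0 < (metricTensor X s).det) :
    InjOn (normalMap X z₀) {y | planeProj y ∈ U ∧ 0 < y 2} := by
  have hcl : ∀ t, X t ∈ closure Ω := fun t =>
    frontier_subset_closure (by rw [hfr]; exact mem_range_self t)
  have hd : ∀ s ∈ U, DifferentiableAt ℝ X s := fun s hs => (hX s hs).differentiableAt two_ne_zero
  rintro y ⟨hyU, hy⟩ y' ⟨hyU', hy'⟩ heq
  have h1 := norm_sq_add_le_of_inner_nonpos hy.le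
    (inner_outerNormal_nonpos hconv hΩ hfr hz₀ (hd _ hyU) (h _ hyU) _ (hcl (planeProj y')))
  have h2 := norm_sq_add_le_of_inner_nonpos hy'.le
    (inner_outerNormal_nonpos hconv hΩ hfr hz₀ (hd _ hyU') (h _ hyU') _ (hcl (planeProj y)))
  unfold normalMap at heq
  rw [heq, add_sub_cancel_left] at h1
  rw [← heq, add_sub_cancel_left] at h2
  rw [norm_smul, norm_smul, norm_outerNormal z₀ (h _ hyU), norm_outerNormal z₀ (h _ hyU'),
    mul_one, mul_one, Real.norm_of_nonneg hy.le, Real.norm_of_nonneg hy'.le] at h1 h2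
  have h3 : ‖X (planeProj y') - X (planeProj y)‖ ^ 2 = 0 := by
    nlinarith [sq_nonneg ‖X (planeProj y') - X (planeProj y)‖,
      sq_nonneg ‖X (planeProj y) - X (planeProj y')‖]
  have hp : planeProj y' = planeProj y :=
    hinj (sub_eq_zero.1 (norm_eq_zero.1 (pow_eq_zero_iff two_ne_zero |>.1 h3)))
  have hyy : y 2 = y' 2 := by
    rw [hp] at h1 h2
    simp only [sub_self, norm_zero] at h1 h2
    exact (pow_left_inj₀ hy.le hy'.le two_ne_zero).1 (by linarith)
  have h0 : y' 0 = y 0 := congrArg (fun p : Plane => p 0) hp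
  have h1' : y' 1 = y 1 := congrArg (fun p : Plane => p 1) hp
  ext i
  fin_cases i
  · exact h0.symm
  · exact h1'.symm
  · exact hyy

/-- The half-lines along the outer normals do not meet the closure of the convex set. -/
theorem normalMap_notMem_closure (hconv : Convex ℝ Ω) (hΩ : IsOpen Ω)
    (hfr : frontier Ω = range X) (hz₀ : z₀ ∈ Ω) {y : Space}
    (hX : DifferentiableAt ℝ X (planeProj y)) (h : 0 < (metricTensor X (planeProj y)).det)
    (hy : 0 < y 2) : normalMap X z₀ y ∉ closure Ω := by
  intro hmem
  have h1 := norm_sq_add_le_of_inner_nonpos hy.le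
    (inner_outerNormal_nonpos hconv hΩ hfr hz₀ hX h _ hmem)
  rw [norm_smul, norm_outerNormal z₀ h, mul_one, Real.norm_of_nonneg hy.le] at h1
  unfold normalMap at h1
  rw [sub_self, norm_zero] at h1
  nlinarith [sq_nonneg ‖X (planeProj y) + y 2 • outerNormal X z₀ (planeProj y)
    - X (planeProj y)‖]

end Normal

/-! ### The trace inequality -/

section TraceInequality

variable {X : Plane → Space} {Ωint Ωext : Set Space}

/-- The parameters at which an admissible surface is regular form an open set `U` of full
measure. -/
theorem IsAdmissibleSurface.exists_regular (hX : IsAdmissibleSurface X Ωint Ωext) :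
    ∃ (U : Set Plane) (c₁ c₂ : ℝ), IsOpen U ∧ volume Uᶜ = 0 ∧ IsCompact (X '' Uᶜ) ∧
      (∀ s ∈ U, ContDiffAt ℝ 2 X s) ∧ 0 < c₁ ∧
      ∀ s ∈ U, ∀ v : Plane, c₁ * ‖v‖ ^ 2 ≤ ‖fderiv ℝ X s v‖ ^ 2 ∧
        ‖fderiv ℝ X s v‖ ^ 2 ≤ c₂ * ‖v‖ ^ 2 := by
  obtain ⟨S, hS, hC2, ⟨c₁, c₂, hc₁, hell⟩, -⟩ := hX.regular
  obtain ⟨c, hc, hlow⟩ := hX.chord_bound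
  have hSc : IsClosed S := hS.isCompact.isClosed
  have hU : IsOpen (X ⁻¹' Sᶜ) := hSc.isOpen_compl.preimage hX.isEmbedding.continuous
  have hcompl : (X ⁻¹' Sᶜ)ᶜ = X ⁻¹' S := by rw [preimage_compl, compl_compl]
  refine ⟨X ⁻¹' Sᶜ, c₁, c₂, hU, ?_, ?_, fun s hs => hC2.contDiffAt (hU.mem_nhds hs), hc₁, ?_⟩
  · rw [hcompl]
    exact volume_preimage_singularSet hS hc hlow
  · rw [hcompl]
    have hsub : S ⊆ range X := by
      obtain ⟨curves, points, -, -, hC, hp, rfl⟩ := hS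
      exact union_subset (sUnion_subset fun C hCm => (hC C hCm).2) hp
    rw [image_preimage_eq_of_subset hsub]
    exact hS.isCompact
  · intro s hs v
    rw [← metricTensor_quadratic]
    exact hell s hs v

/-- The interior region contains balls of any radius. -/
theorem IsAdmissibleSurface.exists_ball_subset (hX : IsAdmissibleSurface X Ωint Ωext) {R : ℝ}
    (hR : 0 < R) : ∃ x₀ : Space, Metric.ball x₀ R ⊆ Ωint := by
  obtain ⟨U, c₁, c₂, hU, -, hUc, hC2, hc₁, hell⟩ := hX.exists_regular
  obtain ⟨c, hc, hlow⟩ := hX.chord_bound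
  obtain ⟨D, hD⟩ := hUc.isBounded.exists_norm_le
  have hL : 0 < √c₂ + 1 := by positivity
  refine SurfaceDelta.exists_ball_subset hX.isEmbedding.continuous hX.convex_int
    hX.divides.isOpen_int hX.divides.frontier_int hc hlow hL
    (norm_sub_le_of_fderiv_le_off hX.isEmbedding.continuous hU.isClosed_compl hL.le
      (le_max_right D 0) (fun s hs => ?_) (fun s hs => ?_) (fun s hs => ?_)) R hR
  · exact (hC2 s (not_not.1 hs)).differentiableAt two_ne_zero
  · refine ContinuousLinearMap.opNorm_le_bound _ hL.le fun v => ?_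
    have h1 := (hell s (not_not.1 hs) v).2
    have h2 := Real.sqrt_le_sqrt h1
    rw [Real.sqrt_sq (norm_nonneg _), Real.sqrt_mul' _ (sq_nonneg _),
      Real.sqrt_sq (norm_nonneg _)] at h2
    nlinarith [norm_nonneg v]
  · exact (hD _ (mem_image_of_mem X hs)).trans (le_max_left _ _)

/-- The splitting of the space into the plane of the first two coordinates and the last axis. -/
def splitHeight : Space ≃ᵐ Plane × ℝ :=
  ((MeasurableEquiv.toLp 2 (Fin 3 → ℝ)).symm.trans
    (MeasurableEquiv.piFinSuccAbove (fun _ : Fin 3 => ℝ) 2)).trans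
    (MeasurableEquiv.prodComm.trans
      ((MeasurableEquiv.toLp 2 (Fin 2 → ℝ)).prodCongr (MeasurableEquiv.refl ℝ)))

theorem splitHeight_apply (y : Space) : splitHeight y = (planeProj y, y 2) := by
  refine Prod.ext ?_ rfl
  ext i
  fin_cases i <;> rfl

theorem measurePreserving_splitHeight : MeasurePreserving splitHeight := by
  refine MeasurePreserving.trans (MeasurePreserving.trans ?_
    (volume_preserving_piFinSuccAbove (fun _ : Fin 3 => ℝ) 2)) (MeasurePreserving.trans
      (Measure.measurePreserving_swap) (MeasurePreserving.prod ?_ (MeasurePreserving.id _)))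
  · exact EuclideanSpace.volume_preserving_symm_measurableEquiv_toLp (Fin 3)
  · exact (EuclideanSpace.volume_preserving_symm_measurableEquiv_toLp (Fin 2)).symm

theorem measurable_metricTensor_det (X : Plane → Space) :
    Measurable fun s => (metricTensor X s).det := by
  have h : ∀ i, Measurable (tangent X i) := fun i => measurable_fderiv_apply_const ℝ X _
  simp only [det_metricTensor]
  exact (((h 0).norm.pow_const 2).mul ((h 1).norm.pow_const 2)).sub
    (((h 0).inner (h 1)).pow_const 2)

/-- The half-lines along the outer normals are disjoint and lie in the exterior region, and the
map of the normal coordinates does not decrease the volume. So an integral over the surface is bounded by an integral over the exterior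
region, if the integrand on the surface is bounded by the integrals along half-lines. -/
theorem IsAdmissibleSurface.lintegral_surfaceMeasure_le (hX : IsAdmissibleSurface X Ωint Ωext)
    {g h : Space → ℝ≥0∞} (hg : Measurable g) (hh : Measurable h)
    (hgh : ∀ x ν : Space, ‖ν‖ = 1 → h x ≤ ∫⁻ t in Ioi (0 : ℝ), g (x + t • ν)) :
    ∫⁻ s, h (X s) ∂(surfaceMeasure X) ≤ ∫⁻ x in Ωext, g x := by
  obtain ⟨U, c₁, c₂, hU, hU0, -, hC2, hc₁, hell⟩ := hX.exists_regular
  obtain ⟨z₀, hz₀⟩ := hX.divides.isConnected_int.nonempty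
  have hXc : Continuous X := hX.isEmbedding.continuous
  have hΩ := hX.divides.isOpen_int
  have hfr := hX.divides.frontier_int
  have hconv := hX.convex_int
  have hd : ∀ s ∈ U, DifferentiableAt ℝ X s := fun s hs => (hC2 s hs).differentiableAt two_ne_zero
  have hdet : ∀ s ∈ U, 0 < (metricTensor X s).det := fun s hs =>
    det_metricTensor_pos hc₁ fun v => by
      rw [metricTensor_quadratic]
      exact (hell s hs v).1
  have hνd : ∀ s ∈ U, DifferentiableAt ℝ (outerNormal X z₀) s := fun s hs =>
    differentiableAt_outerNormal hconv hΩ hfr hz₀ (hC2 s hs) (hdet s hs)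
  let w : Plane → ℝ≥0∞ := fun s => ENNReal.ofReal √(metricTensor X s).det
  have hw : Measurable w := (measurable_metricTensor_det X).sqrt.ennreal_ofReal
  let V : Set (Plane × ℝ) := U ×ˢ Ioi 0
  have hV : MeasurableSet V := hU.measurableSet.prod measurableSet_Ioi
  let Φ : Plane × ℝ → Space := fun p => X p.1 + p.2 • outerNormal X z₀ p.1
  have hΦ : ContinuousOn Φ V := by
    have hν : ContinuousOn (outerNormal X z₀) U := fun s hs =>
      (hνd s hs).continuousAt.continuousWithinAt
    exact (hXc.comp continuous_fst).continuousOn.add (continuous_snd.continuousOn.smul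
      (hν.comp continuous_fst.continuousOn fun p hp => hp.1))
  have hpre : splitHeight ⁻¹' V = {y | planeProj y ∈ U ∧ 0 < y 2} := by
    ext y
    rw [mem_preimage, splitHeight_apply]
    rfl
  calc ∫⁻ s, h (X s) ∂(surfaceMeasure X)
      = ∫⁻ s in U, w s * h (X s) := by
        rw [surfaceMeasure]
        refine (lintegral_withDensity_eq_lintegral_mul _ hw (hh.comp hXc.measurable)).trans ?_
        have hae : (U : Set Plane) =ᵐ[volume] univ := by
          rw [ae_eq_univ]; exact hU0
        rw [Measure.restrict_congr_set hae, Measure.restrict_univ]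
        rfl
    _ ≤ ∫⁻ s in U, ∫⁻ t in Ioi (0 : ℝ), w s * g (Φ (s, t)) := by
        refine setLIntegral_mono_ae' hU.measurableSet (Filter.Eventually.of_forall fun s hs => ?_)
        rw [lintegral_const_mul' _ _ ENNReal.ofReal_ne_top]
        gcongr
        exact hgh _ _ (norm_outerNormal z₀ (hdet s hs))
    _ = ∫⁻ p in V, w p.1 * g (Φ p) := by
        rw [Measure.volume_eq_prod, ← Measure.prod_restrict, lintegral_prod]
        rw [Measure.prod_restrict, ← Measure.volume_eq_prod]
        exact (hw.comp measurable_fst).aemeasurable.mul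
          (hg.comp_aemeasurable (hΦ.aemeasurable hV))
    _ = ∫⁻ y in {y | planeProj y ∈ U ∧ 0 < y 2}, w (planeProj y) * g (normalMap X z₀ y) := by
        rw [← measurePreserving_splitHeight.setLIntegral_comp_preimage_emb
          splitHeight.measurableEmbedding, hpre]
        simp only [splitHeight_apply]
        rfl
    _ ≤ ∫⁻ y in {y | planeProj y ∈ U ∧ 0 < y 2}, ENNReal.ofReal
          |(adjoinColumn (fderiv ℝ X (planeProj y)
            + y 2 • fderiv ℝ (outerNormal X z₀) (planeProj y))
            (outerNormal X z₀ (planeProj y))).det| * g (normalMap X z₀ y) := by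
        refine setLIntegral_mono_ae' (hpre ▸ splitHeight.measurable hV)
          (Filter.Eventually.of_forall fun y hy => ?_)
        gcongr
        exact ENNReal.ofReal_le_ofReal <| gram_le_abs_det _ _ _ (norm_outerNormal z₀ (hdet _ hy.1))
          (inner_fderiv_outerNormal X z₀ _)
          (inner_fderiv_fderiv_outerNormal_nonneg hconv hΩ hfr hz₀ hU hC2 hdet hy.1) hy.2.le
    _ = ∫⁻ x in normalMap X z₀ '' {y | planeProj y ∈ U ∧ 0 < y 2}, g x :=
        (lintegral_image_eq_lintegral_abs_det_fderiv_mul volume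
          (hpre ▸ splitHeight.measurable hV)
          (fun y hy => (hasFDerivAt_normalMap (hd _ hy.1) (hνd _ hy.1)).hasFDerivWithinAt)
          (injOn_normalMap hconv hΩ hfr hX.isEmbedding.injective hz₀ hC2 hdet) g).symm
    _ ≤ ∫⁻ x in Ωext, g x := by
        refine lintegral_mono_set ?_
        rintro _ ⟨y, hy, rfl⟩
        have h1 := normalMap_notMem_closure hconv hΩ hfr hz₀ (hd _ hy.1) (hdet _ hy.1) hy.2
        have h2 : normalMap X z₀ y ∈ (range X)ᶜ := fun h3 =>
          h1 (frontier_subset_closure (by rw [hfr]; exact h3))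
        rw [← hX.divides.union_eq] at h2
        exact h2.resolve_left fun h3 => h1 (subset_closure h3)

/-- The length of the gradient of a function. -/
def gradNorm (φ : Space → ℂ) (x : Space) : ℝ :=
  √(∑ i, ‖fderiv ℝ φ x (EuclideanSpace.single i 1)‖ ^ 2)

theorem space_eq_sum (v : Space) : v = ∑ i, v i • EuclideanSpace.single i (1 : ℝ) := by
  ext i
  simp [Pi.single_apply]

theorem norm_fderiv_le_gradNorm (φ : Space → ℂ) (x ν : Space) (hν : ‖ν‖ = 1) :
    ‖fderiv ℝ φ x ν‖ ≤ gradNorm φ x := by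
  conv_lhs => rw [space_eq_sum ν]
  rw [map_sum]
  refine (norm_sum_le _ _).trans ?_
  have h1 := Real.sum_mul_le_sqrt_mul_sqrt Finset.univ (fun i => ‖ν i‖)
    (fun i => ‖fderiv ℝ φ x (EuclideanSpace.single i 1)‖)
  rw [← EuclideanSpace.norm_eq, hν, one_mul] at h1
  simp only [map_smul, norm_smul]
  exact h1

theorem continuous_gradNorm {φ : Space → ℂ} (hφ : ContDiff ℝ 1 φ) : Continuous (gradNorm φ) := by
  have h : Continuous (fderiv ℝ φ) := hφ.continuous_fderiv one_ne_zero
  unfold gradNorm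
  fun_prop

/-- A test function is estimated at a point by its integral along a half-line. -/
theorem enorm_sq_le_lintegral_Ioi {φ : Space → ℂ} (hφ : ContDiff ℝ 1 φ)
    (hc : HasCompactSupport φ) (x ν : Space) (hν : ‖ν‖ = 1) :
    ENNReal.ofReal (‖φ x‖ ^ 2)
      ≤ ∫⁻ t in Ioi (0 : ℝ), ENNReal.ofReal (2 * ‖φ (x + t • ν)‖ * gradNorm φ (x + t • ν)) := by
  let f : ℝ → ℝ := fun t => ‖φ (x + t • ν)‖ ^ 2
  have hline : ∀ t, HasDerivAt (fun t : ℝ => x + t • ν) ν t := fun t => by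
    have h := ((hasDerivAt_id t).smul_const ν).const_add x
    rwa [one_smul] at h
  have hcomp : ContDiff ℝ 1 fun t : ℝ => φ (x + t • ν) :=
    hφ.comp (contDiff_const.add (contDiff_id.smul contDiff_const))
  have hf : ContDiff ℝ 1 f := hcomp.norm_sq ℝ
  have hemb : IsClosedEmbedding fun t : ℝ => x + t • ν := by
    refine Isometry.isClosedEmbedding (Isometry.of_dist_eq fun a b => ?_)
    rw [dist_add_left, dist_eq_norm, ← sub_smul, norm_smul, hν, mul_one, dist_eq_norm]
  have hfc : HasCompactSupport f := by
    have h1 : HasCompactSupport fun t : ℝ => φ (x + t • ν) := hc.comp_isClosedEmbedding hemb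
    exact h1.comp_left (g := fun z : ℂ => ‖z‖ ^ 2) (by simp)
  have hderiv : ∀ t, deriv f t
      = 2 * ⟪φ (x + t • ν), fderiv ℝ φ (x + t • ν) ν⟫_ℝ := fun t =>
    (((hφ.differentiable one_ne_zero _).hasFDerivAt.comp_hasDerivAt t (hline t)).norm_sq).deriv
  have hint := hfc.integral_Ioi_deriv_eq hf 0
  calc ENNReal.ofReal (‖φ x‖ ^ 2) = ‖∫ t in Ioi (0 : ℝ), deriv f t‖ₑ := by
        rw [hint, enorm_neg, Real.enorm_eq_ofReal (by positivity)]
        simp [f]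
    _ ≤ ∫⁻ t in Ioi (0 : ℝ), ‖deriv f t‖ₑ := enorm_integral_le_lintegral_enorm _
    _ ≤ _ := by
        refine lintegral_mono fun t => ?_
        rw [← ofReal_norm, hderiv, norm_mul, Real.norm_two, mul_assoc]
        gcongr
        refine (abs_real_inner_le_norm _ _).trans ?_
        gcongr
        exact norm_fderiv_le_gradNorm φ _ ν hν

/-- The trace inequality on the exterior side of the convex surface. -/
theorem IsAdmissibleSurface.lintegral_trace_le (hX : IsAdmissibleSurface X Ωint Ωext)
    {φ : Space → ℂ} (hφ : ContDiff ℝ 1 φ) (hc : HasCompactSupport φ) :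
    ∫⁻ s, ENNReal.ofReal (‖φ (X s)‖ ^ 2) ∂(surfaceMeasure X)
      ≤ ∫⁻ x in Ωext, ENNReal.ofReal (2 * ‖φ x‖ * gradNorm φ x) := by
  have hcont := hφ.continuous
  have hgrad := continuous_gradNorm hφ
  exact hX.lintegral_surfaceMeasure_le
    (g := fun x => ENNReal.ofReal (2 * ‖φ x‖ * gradNorm φ x))
    (h := fun x => ENNReal.ofReal (‖φ x‖ ^ 2))
    (by fun_prop) (by fun_prop) (enorm_sq_le_lintegral_Ioi hφ hc)

end TraceInequality

/-! ### The Sobolev space as a Hilbert space -/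

section Sobolev

open scoped Laplacian FourierTransform

/-- The `i`-th vector of the standard basis of the space. -/
abbrev stdVec (i : Fin 3) : Space := EuclideanSpace.single i 1

/-- A square integrable function is determined by its distribution. -/
theorem toTemperedDistribution_injective {u v : L2} (h : (u : 𝓢'(Space, ℂ)) = v) : u = v := by
  have hker := Lp.ker_toTemperedDistributionCLM_eq_bot (E := Space) (F := ℂ) (μ := volume)
    (p := 2)
  exact LinearMap.ker_eq_bot.1 hker h

theorem IsWeakGradient.unique {u : L2} {G G' : Fin 3 → L2} (h : IsWeakGradient u G)
    (h' : IsWeakGradient u G') : G = G' := by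
  funext i
  exact toTemperedDistribution_injective ((h i).symm.trans (h' i))

theorem IsWeakGradient.weakGradient_eq {u : L2} {G : Fin 3 → L2} (h : IsWeakGradient u G) :
    weakGradient u = G := by
  have hex : ∃ G : Fin 3 → L2, IsWeakGradient u G := ⟨G, h⟩
  rw [weakGradient, dif_pos hex]
  exact hex.choose_spec.unique h

theorem isWeakGradient_toLp (φ : 𝓢(Space, ℂ)) :
    IsWeakGradient (φ.toLp 2) fun i => (∂_{stdVec i} φ).toLp 2 := by
  intro i
  rw [Lp.toTemperedDistribution_toLp_eq, Lp.toTemperedDistribution_toLp_eq,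
    TemperedDistribution.lineDerivOp_toTemperedDistributionCLM_eq]

/-- The Hilbert space of quadruples `(u, G)` of square integrable functions, which are thought of
as a function and its three partial derivatives. -/
abbrev Jet : Type := PiLp 2 fun _ : Fin 4 => L2

/-- The defect `∂ᵢu - Gᵢ` of a quadruple `(u, G)`, as a tempered distribution. -/
def gradientDefect (i : Fin 3) : Jet →L[ℂ] 𝓢'(Space, ℂ) :=
  LineDeriv.lineDerivOpCLM ℂ 𝓢'(Space, ℂ) (stdVec i) ∘L Lp.toTemperedDistributionCLM ℂ volume 2 ∘L
      PiLp.proj 2 (fun _ : Fin 4 => L2) 0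
    - Lp.toTemperedDistributionCLM ℂ volume 2 ∘L PiLp.proj 2 (fun _ : Fin 4 => L2) i.succ

/-- The Sobolev space `H¹`, as the closed subspace of the pairs `(u, ∇u)`. -/
def sobolevSpace : Submodule ℂ Jet := ⨅ i, LinearMap.ker (gradientDefect i).toLinearMap

theorem mem_sobolevSpace {p : Jet} :
    p ∈ sobolevSpace ↔ IsWeakGradient (p 0) fun i => p i.succ := by
  simp only [sobolevSpace, Submodule.mem_iInf, LinearMap.mem_ker]
  refine forall_congr' fun i => ?_
  exact sub_eq_zero

theorem isClosed_sobolevSpace : IsClosed (sobolevSpace : Set Jet) := by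
  rw [sobolevSpace, Submodule.coe_iInf]
  exact isClosed_iInter fun i => (gradientDefect i).isClosed_ker

instance : CompleteSpace sobolevSpace := isClosed_sobolevSpace.completeSpace_coe

/-- The embedding of `H¹` into `L²`. -/
def sobolevToL2 : sobolevSpace →L[ℂ] L2 :=
  PiLp.proj 2 (fun _ : Fin 4 => L2) 0 ∘L sobolevSpace.subtypeL

/-- The weak partial derivative on `H¹`. -/
def sobolevDeriv (i : Fin 3) : sobolevSpace →L[ℂ] L2 :=
  PiLp.proj 2 (fun _ : Fin 4 => L2) i.succ ∘L sobolevSpace.subtypeL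

theorem isWeakGradient_sobolev (p : sobolevSpace) :
    IsWeakGradient (sobolevToL2 p) fun i => sobolevDeriv i p :=
  mem_sobolevSpace.1 p.2

theorem weakGradient_sobolevToL2 (p : sobolevSpace) (i : Fin 3) :
    weakGradient (sobolevToL2 p) i = sobolevDeriv i p := by
  rw [(isWeakGradient_sobolev p).weakGradient_eq]

theorem inner_sobolevSpace (p p' : sobolevSpace) :
    ⟪p, p'⟫_ℂ = ⟪sobolevToL2 p, sobolevToL2 p'⟫_ℂ
      + ∑ i, ⟪sobolevDeriv i p, sobolevDeriv i p'⟫_ℂ := by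
  rw [Submodule.coe_inner, PiLp.inner_apply, Fin.sum_univ_succ]
  rfl

theorem norm_sq_sobolevSpace (p : sobolevSpace) :
    ‖p‖ ^ 2 = ‖sobolevToL2 p‖ ^ 2 + ∑ i, ‖sobolevDeriv i p‖ ^ 2 := by
  change ‖(p : Jet)‖ ^ 2 = _
  rw [PiLp.norm_sq_eq_of_L2, Fin.sum_univ_succ]
  rfl

theorem sobolevToL2_injective : Function.Injective sobolevToL2 := by
  intro p p' h
  have h1 := (isWeakGradient_sobolev p).unique (h ▸ isWeakGradient_sobolev p')
  apply Subtype.ext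
  ext1 i
  refine Fin.cases ?_ (fun i => ?_) i
  · exact h
  · exact congrFun h1 i

/-- The element of `H¹` given by a function and its weak gradient. -/
def mkSobolev (u : L2) (G : Fin 3 → L2) (h : IsWeakGradient u G) : sobolevSpace :=
  ⟨WithLp.toLp 2 (Fin.cons u G), mem_sobolevSpace.2 (by simpa using h)⟩

theorem range_sobolevToL2 : range sobolevToL2 = H1 := by
  ext u
  constructor
  · rintro ⟨p, rfl⟩
    exact ⟨_, isWeakGradient_sobolev p⟩
  · rintro ⟨G, hG⟩
    exact ⟨mkSobolev u G hG, rfl⟩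

/-- The element of `H¹` given by a Schwartz function. -/
def schwartzToSobolev : 𝓢(Space, ℂ) →ₗ[ℂ] sobolevSpace where
  toFun φ := mkSobolev _ _ (isWeakGradient_toLp φ)
  map_add' φ φ' := sobolevToL2_injective (by
    rw [map_add]
    exact map_add (SchwartzMap.toLpCLM ℂ ℂ 2 volume) φ φ')
  map_smul' c φ := sobolevToL2_injective (by
    rw [map_smul]
    exact map_smul (SchwartzMap.toLpCLM ℂ ℂ 2 volume) c φ)

@[simp]
theorem sobolevToL2_schwartz (φ : 𝓢(Space, ℂ)) : sobolevToL2 (schwartzToSobolev φ) = φ.toLp 2 :=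
  rfl

@[simp]
theorem sobolevDeriv_schwartz (φ : 𝓢(Space, ℂ)) (i : Fin 3) :
    sobolevDeriv i (schwartzToSobolev φ) = (∂_{stdVec i} φ).toLp 2 := rfl

theorem denseRange_sobolevToL2 : DenseRange sobolevToL2 := by
  have h := SchwartzMap.denseRange_toLpCLM (E := Space) (F := ℂ) (μ := volume) (p := 2)
    ENNReal.ofNat_ne_top
  refine h.mono ?_
  rintro _ ⟨φ, rfl⟩
  exact ⟨schwartzToSobolev φ, rfl⟩

/-- The equation `g - Δg = f` can be solved in the Schwartz space, by the Fourier transform. -/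
theorem exists_sub_laplacian_eq (f : 𝓢(Space, ℂ)) :
    ∃ g : 𝓢(Space, ℂ), g - ∑ i, ∂_{stdVec i} (∂_{stdVec i} g) = f := by
  let m : Space → ℝ := fun ξ => (1 + ‖(2 * Real.pi) • ξ‖ ^ 2) ^ (-1 : ℝ)
  have hm : m.HasTemperateGrowth := by
    have h1 := Function.hasTemperateGrowth_one_add_norm_sq_rpow Space (-1)
    exact h1.comp (f := fun ξ : Space => (2 * Real.pi) • ξ) (by fun_prop)
  have hn : (fun ξ : Space => ‖ξ‖ ^ 2).HasTemperateGrowth := by fun_prop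
  refine ⟨SchwartzMap.fourierMultiplierCLM ℂ m f, ?_⟩
  have hlap := SchwartzMap.laplacian_eq_sum (EuclideanSpace.basisFun (Fin 3) ℝ)
    (SchwartzMap.fourierMultiplierCLM ℂ m f)
  simp only [EuclideanSpace.basisFun_apply] at hlap
  rw [← hlap, SchwartzMap.laplacian_eq_fourierMultiplierCLM]
  have hcomp := SchwartzMap.fourierMultiplierCLM_fourierMultiplierCLM_apply hn hm f
  have hinv : SchwartzMap.smulLeftCLM ℂ m (𝓕 f) + ((2 * Real.pi) ^ 2 : ℝ) •
      SchwartzMap.smulLeftCLM ℂ ((fun ξ : Space => ‖ξ‖ ^ 2) * m) (𝓕 f) = 𝓕 f := by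
    ext ξ
    simp only [add_apply, smul_apply,
      SchwartzMap.smulLeftCLM_apply_apply hm, SchwartzMap.smulLeftCLM_apply_apply (hn.mul hm)]
    rw [smul_smul, ← add_smul]
    have h1 : m ξ + (2 * Real.pi) ^ 2 * ((fun ξ : Space => ‖ξ‖ ^ 2) * m) ξ = 1 := by
      have h2 : (1 : ℝ) + ‖(2 * Real.pi) • ξ‖ ^ 2 ≠ 0 := by positivity
      simp only [m, Pi.mul_apply, Real.rpow_neg_one]
      rw [norm_smul, Real.norm_of_nonneg Real.two_pi_pos.le, mul_pow] at *
      field_simp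
    rw [h1, one_smul]
  have hfin := congrArg (fun h : 𝓢(Space, ℂ) => 𝓕⁻ h) hinv
  simp only [FourierTransform.fourierInv_add, FourierTransform.fourierInv_smul,
    FourierTransform.fourierInv_fourier_eq] at hfin
  rw [← SchwartzMap.fourierMultiplierCLM_apply, ← SchwartzMap.fourierMultiplierCLM_apply,
    ← hcomp] at hfin
  rw [neg_smul, sub_neg_eq_add]
  exact hfin

/-- A smooth cutoff function, equal to one on the unit ball and supported in the ball of
radius two. -/
def cutoff : ContDiffBump (0 : Space) := ⟨1, 2, one_pos, one_lt_two⟩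

/-- The cutoff function scaled to the ball of radius `n + 1`. -/
def scaledCutoff (n : ℕ) (x : Space) : ℂ := (cutoff (((n : ℝ) + 1)⁻¹ • x) : ℂ)

theorem contDiff_scaledCutoff (n : ℕ) : ContDiff ℝ ∞ (scaledCutoff n) :=
  Complex.ofRealCLM.contDiff.comp (cutoff.contDiff.comp (contDiff_const_smul _))

theorem hasCompactSupport_scaledCutoff (n : ℕ) : HasCompactSupport (scaledCutoff n) := by
  have h : HasCompactSupport fun x : Space => cutoff (((n : ℝ) + 1)⁻¹ • x) :=
    cutoff.hasCompactSupport.comp_smul (by positivity)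
  exact h.comp_left (g := fun a : ℝ => (a : ℂ)) (by simp)

theorem norm_scaledCutoff_le (n : ℕ) (x : Space) : ‖scaledCutoff n x‖ ≤ 1 := by
  rw [scaledCutoff, Complex.norm_real, Real.norm_of_nonneg cutoff.nonneg]
  exact cutoff.le_one

theorem tendsto_scaledCutoff (x : Space) :
    Tendsto (fun n => scaledCutoff n x) atTop (𝓝 1) := by
  refine tendsto_const_nhds.congr' ?_
  obtain ⟨N, hN⟩ := exists_nat_ge ‖x‖
  filter_upwards [eventually_ge_atTop N] with n hn
  rw [scaledCutoff, cutoff.one_of_mem_closedBall, Complex.ofReal_one]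
  rw [mem_closedBall_zero_iff, norm_smul, norm_inv, Real.norm_of_nonneg (by positivity),
    inv_mul_le_iff₀ (by positivity)]
  have : (N : ℝ) ≤ n := by exact_mod_cast hn
  change ‖x‖ ≤ (n + 1) * 1
  linarith

theorem exists_norm_fderiv_scaledCutoff_le : ∃ C : ℝ, ∀ n x (v : Space), ‖v‖ = 1 →
    ‖fderiv ℝ (scaledCutoff n) x v‖ ≤ C * ((n : ℝ) + 1)⁻¹ := by
  obtain ⟨C, hC⟩ := ((contDiff_scaledCutoff 0).continuous_fderiv (by simp)).bounded_above_of_compact_support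
    ((hasCompactSupport_scaledCutoff 0).fderiv ℝ)
  refine ⟨C, fun n x v hv => ?_⟩
  have h1 : scaledCutoff n = fun x => scaledCutoff 0 (((n : ℝ) + 1)⁻¹ • x) := by
    funext x
    simp [scaledCutoff]
  have h2 : HasFDerivAt (scaledCutoff n) ((fderiv ℝ (scaledCutoff 0) (((n : ℝ) + 1)⁻¹ • x)).comp
      (((n : ℝ) + 1)⁻¹ • ContinuousLinearMap.id ℝ Space)) x := by
    rw [h1]
    exact ((contDiff_scaledCutoff 0).differentiable (by simp) _).hasFDerivAt.comp x
      (((n : ℝ) + 1)⁻¹ • ContinuousLinearMap.id ℝ Space).hasFDerivAt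
  rw [h2.fderiv]
  simp only [ContinuousLinearMap.comp_apply, smul_apply, ContinuousLinearMap.id_apply, map_smul]
  rw [norm_smul, Real.norm_of_nonneg (by positivity), mul_comm]
  gcongr
  refine (ContinuousLinearMap.le_opNorm _ _).trans ?_
  rw [hv, mul_one]
  exact hC _

/-- The product of a Schwartz function with the scaled cutoff. -/
def truncate (n : ℕ) (g : 𝓢(Space, ℂ)) : 𝓢(Space, ℂ) :=
  SchwartzMap.smulLeftCLM ℂ (scaledCutoff n) g

theorem truncate_apply (n : ℕ) (g : 𝓢(Space, ℂ)) (x : Space) :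
    truncate n g x = scaledCutoff n x * g x := by
  rw [truncate, SchwartzMap.smulLeftCLM_apply_apply
    ((hasCompactSupport_scaledCutoff n).hasTemperateGrowth (contDiff_scaledCutoff n)), smul_eq_mul]

theorem hasCompactSupport_truncate (n : ℕ) (g : 𝓢(Space, ℂ)) :
    HasCompactSupport (truncate n g) := by
  have : (truncate n g : Space → ℂ) = fun x => scaledCutoff n x * g x :=
    funext (truncate_apply n g)
  rw [this]
  exact (hasCompactSupport_scaledCutoff n).mul_right

theorem lineDeriv_truncate (n : ℕ) (g : 𝓢(Space, ℂ)) (v x : Space) :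
    (∂_{v} (truncate n g)) x
      = scaledCutoff n x * (∂_{v} g) x + fderiv ℝ (scaledCutoff n) x v * g x := by
  have h1 : (truncate n g : Space → ℂ) = scaledCutoff n * g := funext (truncate_apply n g)
  have h2 := (((contDiff_scaledCutoff n).differentiable (by simp) x).hasFDerivAt.mul
    (g.hasFDerivAt x)).fderiv
  rw [SchwartzMap.lineDerivOp_apply_eq_fderiv, SchwartzMap.lineDerivOp_apply_eq_fderiv, h1, h2]
  simp only [add_apply, smul_apply, smul_eq_mul]
  ring

theorem integrable_schwartz_mul (g : 𝓢(Space, ℂ)) (u : L2) : Integrable fun x => g x * u x :=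
  (g.memLp 2).integrable_mul (Lp.memLp u)

theorem tendsto_fderiv_scaledCutoff (x v : Space) (hv : ‖v‖ = 1) :
    Tendsto (fun n => fderiv ℝ (scaledCutoff n) x v) atTop (𝓝 0) := by
  obtain ⟨C, hC⟩ := exists_norm_fderiv_scaledCutoff_le
  refine squeeze_zero_norm (fun n => hC n x v hv) ?_
  have hinv : Tendsto (fun n : ℕ => ((n : ℝ) + 1)⁻¹) atTop (𝓝 0) := by
    simpa [one_div] using tendsto_one_div_add_atTop_nhds_zero_nat (𝕜 := ℝ)
  simpa using hinv.const_mul C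

theorem tendsto_integral_lineDeriv_truncate (g : 𝓢(Space, ℂ)) (u : L2) (v : Space)
    (hv : ‖v‖ = 1) : Tendsto (fun n => ∫ x, (∂_{v} (truncate n g)) x * u x) atTop
      (𝓝 (∫ x, (∂_{v} g) x * u x)) := by
  obtain ⟨C, hC⟩ := exists_norm_fderiv_scaledCutoff_le
  have hC0 : 0 ≤ C := by
    have := (norm_nonneg _).trans (hC 0 0 v hv)
    simpa using this
  have hbound : Integrable fun x => ‖(∂_{v} g) x * u x‖ + C * ‖g x * u x‖ :=
    (integrable_schwartz_mul (∂_{v} g) u).norm.add ((integrable_schwartz_mul g u).norm.const_mul C)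
  refine tendsto_integral_of_dominated_convergence _
    (fun n => (integrable_schwartz_mul (∂_{v} (truncate n g)) u).aestronglyMeasurable) hbound
    (fun n => Filter.Eventually.of_forall fun x => ?_) (Filter.Eventually.of_forall fun x => ?_)
  · rw [lineDeriv_truncate, add_mul, mul_assoc, mul_assoc]
    refine (norm_add_le _ _).trans (add_le_add ?_ ?_)
    · rw [norm_mul]
      exact mul_le_of_le_one_left (norm_nonneg _) (norm_scaledCutoff_le n x)
    · rw [norm_mul]
      refine mul_le_mul_of_nonneg_right ((hC n x v hv).trans ?_) (norm_nonneg _)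
      refine mul_le_of_le_one_right hC0 (inv_le_one_of_one_le₀ ?_)
      have : (0 : ℝ) ≤ n := n.cast_nonneg
      linarith
  · have h1 := (((tendsto_scaledCutoff x).mul_const ((∂_{v} g) x)).add
      ((tendsto_fderiv_scaledCutoff x v hv).mul_const (g x))).mul_const (u x)
    rw [one_mul, zero_mul, add_zero] at h1
    simp only [lineDeriv_truncate]
    exact h1

/-- A pair of a square integrable function and a square integrable field which pairs to zero with
all test functions and their gradients pairs to zero with all Schwartz functions. -/
theorem pairing_eq_zero_of_compactSupport {u : L2} {G : Fin 3 → L2}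
    (h : ∀ g : 𝓢(Space, ℂ), HasCompactSupport g →
      (∫ x, g x * u x) + ∑ i, ∫ x, (∂_{stdVec i} g) x * G i x = 0) (g : 𝓢(Space, ℂ)) :
    (∫ x, g x * u x) + ∑ i, ∫ x, (∂_{stdVec i} g) x * G i x = 0 := by
  have h0 : Tendsto (fun n => ∫ x, truncate n g x * u x) atTop (𝓝 (∫ x, g x * u x)) := by
    refine tendsto_integral_of_dominated_convergence (fun x => ‖g x * u x‖)
      (fun n => (integrable_schwartz_mul _ _).aestronglyMeasurable)
      (integrable_schwartz_mul g u).norm (fun n => ?_) ?_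
    · filter_upwards with x
      rw [truncate_apply, mul_assoc, norm_mul]
      exact mul_le_of_le_one_left (norm_nonneg _) (norm_scaledCutoff_le n x)
    · filter_upwards with x
      have := ((tendsto_scaledCutoff x).mul_const (g x)).mul_const (u x)
      simp only [truncate_apply]
      rwa [one_mul] at this
  have hlim := h0.add (tendsto_finsetSum Finset.univ fun i _ =>
    tendsto_integral_lineDeriv_truncate g (G i) (stdVec i) (by simp))
  refine tendsto_nhds_unique hlim ?_
  exact tendsto_const_nhds.congr fun n => (h _ (hasCompactSupport_truncate n g)).symm

/-- The complex conjugate of a Schwartz function. -/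
def conjSchwartz (g : 𝓢(Space, ℂ)) : 𝓢(Space, ℂ) :=
  SchwartzMap.postcompCLM (𝕜 := ℝ) Complex.conjCLE.toContinuousLinearMap g

theorem conjSchwartz_apply (g : 𝓢(Space, ℂ)) (x : Space) :
    conjSchwartz g x = (starRingEnd ℂ) (g x) := rfl

theorem lineDeriv_conjSchwartz (g : 𝓢(Space, ℂ)) (v x : Space) :
    (∂_{v} (conjSchwartz g)) x = (starRingEnd ℂ) ((∂_{v} g) x) := by
  rw [SchwartzMap.lineDerivOp_apply_eq_fderiv, SchwartzMap.lineDerivOp_apply_eq_fderiv]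
  have h := (Complex.conjCLE.toContinuousLinearMap.hasFDerivAt.comp x (g.hasFDerivAt x)).fderiv
  have h1 : (conjSchwartz g : Space → ℂ) = Complex.conjCLE.toContinuousLinearMap ∘ g := rfl
  rw [h1, h]
  rfl

theorem inner_toLp_schwartz (g : 𝓢(Space, ℂ)) (u : L2) :
    ⟪g.toLp 2, u⟫_ℂ = ∫ x, (starRingEnd ℂ) (g x) * u x := by
  rw [L2.inner_def]
  refine integral_congr_ae ?_
  filter_upwards [g.coeFn_toLp 2 volume] with x hx
  rw [hx, RCLike.inner_apply, mul_comm]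

/-- The smooth compactly supported functions. -/
def testFunctions : Submodule ℂ 𝓢(Space, ℂ) where
  carrier := {φ | HasCompactSupport φ}
  add_mem' h h' := HasCompactSupport.add h h'
  zero_mem' := HasCompactSupport.zero
  smul_mem' c _ h := HasCompactSupport.smul_left (f := fun _ => c) h

/-- The embedding of the test functions into `H¹`. -/
def testToSobolev : testFunctions →ₗ[ℂ] sobolevSpace :=
  schwartzToSobolev ∘ₗ testFunctions.subtype

/-- The test functions are dense in `H¹`: what is orthogonal to them solves `u - Δu = 0` in the
sense of distributions. -/
theorem denseRange_testToSobolev : DenseRange testToSobolev := by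
  have hset : range testToSobolev = (LinearMap.range testToSobolev : Set sobolevSpace) := rfl
  rw [DenseRange, hset, Submodule.dense_iff_topologicalClosure_eq_top,
    Submodule.topologicalClosure_eq_top_iff, Submodule.eq_bot_iff]
  intro p hp
  have horth : ∀ g : 𝓢(Space, ℂ), HasCompactSupport g →
      (∫ x, g x * sobolevToL2 p x) + ∑ i, ∫ x, (∂_{stdVec i} g) x * sobolevDeriv i p x = 0 := by
    intro g hg
    have hconj : HasCompactSupport (conjSchwartz g) :=
      HasCompactSupport.comp_left (g := starRingEnd ℂ) hg (map_zero _)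
    have h1 := hp (schwartzToSobolev (conjSchwartz g)) ⟨⟨_, hconj⟩, rfl⟩
    rw [inner_sobolevSpace] at h1
    simpa only [sobolevToL2_schwartz, sobolevDeriv_schwartz, inner_toLp_schwartz,
      conjSchwartz_apply, lineDeriv_conjSchwartz, Complex.conj_conj] using h1
  have hall := pairing_eq_zero_of_compactSupport horth
  have hwg := isWeakGradient_sobolev p
  have hdist : (sobolevToL2 p : 𝓢'(Space, ℂ)) = (0 : L2) := by
    ext f
    obtain ⟨g, rfl⟩ := exists_sub_laplacian_eq f
    have h1 := hall g
    have h2 : ∀ i, ∫ x, (∂_{stdVec i} g) x * sobolevDeriv i p x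
        = -(sobolevToL2 p : 𝓢'(Space, ℂ)) (∂_{stdVec i} (∂_{stdVec i} g)) := by
      intro i
      have h3 := DFunLike.congr_fun (hwg i) (∂_{stdVec i} g)
      rw [TemperedDistribution.lineDerivOp_apply_apply, map_neg,
        Lp.toTemperedDistribution_apply (sobolevDeriv i p)] at h3
      exact h3.symm
    simp only [h2, Finset.sum_neg_distrib] at h1
    rw [map_sub, map_sum]
    have h4 : (sobolevToL2 p : 𝓢'(Space, ℂ)) g = ∫ x, g x * sobolevToL2 p x :=
      Lp.toTemperedDistribution_apply _ _
    have h5 : ((0 : L2) : 𝓢'(Space, ℂ)) = 0 :=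
      map_zero (Lp.toTemperedDistributionCLM ℂ volume 2)
    rw [h4, h5, sub_eq_add_neg]
    exact h1
  exact sobolevToL2_injective (by rw [map_zero]; exact toTemperedDistribution_injective hdist)

end Sobolev

/-! ### The trace operator -/

section TraceOperator

variable {X : Plane → Space} {Ωint Ωext : Set Space}

theorem ofReal_norm_sq_Lp {β : Type*} [MeasurableSpace β] {μ : Measure β} (f : Lp ℂ 2 μ) :
    ENNReal.ofReal (‖f‖ ^ 2) = ∫⁻ x, ENNReal.ofReal (‖f x‖ ^ 2) ∂μ := by
  rw [Lp.norm_def, ← ENNReal.toReal_pow, ENNReal.ofReal_toReal (ENNReal.pow_ne_top (Lp.eLpNorm_ne_top f)),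
    eLpNorm_eq_lintegral_rpow_enorm_toReal (by simp) (by simp)]
  rw [← ENNReal.rpow_natCast, ← ENNReal.rpow_mul]
  simp

theorem ofReal_norm_sq_toLp {β : Type*} [MeasurableSpace β] {μ : Measure β} {f : β → ℂ}
    (hf : MemLp f 2 μ) :
    ENNReal.ofReal (‖hf.toLp f‖ ^ 2) = ∫⁻ x, ENNReal.ofReal (‖f x‖ ^ 2) ∂μ := by
  rw [ofReal_norm_sq_Lp]
  refine lintegral_congr_ae ?_
  filter_upwards [hf.coeFn_toLp] with x hx
  rw [hx]

/-- The restriction of square integrable functions to a region. -/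
def restrictL2 (Ω : Set Space) : L2 →L[ℂ] Lp ℂ 2 (volume.restrict Ω) :=
  LpToLpRestrictCLM Space ℂ ℂ volume 2 Ω

theorem norm_restrictL2_le (Ω : Set Space) (u : L2) : ‖restrictL2 Ω u‖ ≤ ‖u‖ :=
  norm_Lp_toLp_restrict_le Ω u

theorem integral_bias {Ω : Set Space} (hΩ : MeasurableSet Ω) (V₀ : ℝ) (u v : L2) :
    ∫ x, (starRingEnd ℂ) (u x) * (bias Ω V₀ x : ℂ) * v x
      = V₀ * ⟪restrictL2 Ω u, restrictL2 Ω v⟫_ℂ := by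
  rw [L2.inner_def, ← integral_const_mul]
  have h1 : (fun x => (starRingEnd ℂ) (u x) * (bias Ω V₀ x : ℂ) * v x)
      = Ω.indicator fun x => V₀ * ⟪u x, v x⟫_ℂ := by
    funext x
    by_cases hx : x ∈ Ω
    · simp [bias, hx, RCLike.inner_apply]
      ring
    · simp [bias, hx]
  rw [h1, integral_indicator hΩ]
  refine integral_congr_ae ?_
  filter_upwards [LpToLpRestrictCLM_coeFn ℂ Ω u, LpToLpRestrictCLM_coeFn ℂ Ω v] with x hu hv
  rw [restrictL2, hu, hv]

theorem ofReal_gradNorm_sq (φ : 𝓢(Space, ℂ)) (x : Space) :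
    ENNReal.ofReal (gradNorm φ x ^ 2)
      = ∑ i, ENNReal.ofReal (‖(∂_{stdVec i} φ) x‖ ^ 2) := by
  rw [gradNorm, Real.sq_sqrt (by positivity), ENNReal.ofReal_sum_of_nonneg (by intros; positivity)]
  rfl

/-- The trace inequality with a parameter, for test functions. -/
theorem IsAdmissibleSurface.mul_lintegral_trace_le (hX : IsAdmissibleSurface X Ωint Ωext)
    {φ : 𝓢(Space, ℂ)} (hc : HasCompactSupport φ) {t : ℝ} (ht : 0 < t) :
    ENNReal.ofReal t * ∫⁻ s, ENNReal.ofReal (‖φ (X s)‖ ^ 2) ∂(surfaceMeasure X)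
      ≤ ENNReal.ofReal ((∑ i, ‖(∂_{stdVec i} φ).toLp 2‖ ^ 2)
          + t ^ 2 * ‖restrictL2 Ωext (φ.toLp 2)‖ ^ 2) := by
  have hφ : ContDiff ℝ 1 φ := φ.smooth 1
  have hmφ : Measurable fun x => ENNReal.ofReal (‖φ x‖ ^ 2) := by fun_prop
  have hr : ENNReal.ofReal (‖restrictL2 Ωext (φ.toLp 2)‖ ^ 2)
      = ∫⁻ x in Ωext, ENNReal.ofReal (‖φ x‖ ^ 2) := by
    rw [ofReal_norm_sq_Lp]
    refine lintegral_congr_ae ?_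
    filter_upwards [LpToLpRestrictCLM_coeFn ℂ Ωext (φ.toLp 2),
      ae_restrict_of_ae (φ.coeFn_toLp 2 volume)] with x h1 h2
    rw [restrictL2, h1, h2]
  have hd : ∀ i, ENNReal.ofReal (‖(∂_{stdVec i} φ).toLp 2‖ ^ 2)
      = ∫⁻ x, ENNReal.ofReal (‖(∂_{stdVec i} φ) x‖ ^ 2) := fun i =>
    ofReal_norm_sq_toLp ((∂_{stdVec i} φ).memLp 2)
  calc ENNReal.ofReal t * ∫⁻ s, ENNReal.ofReal (‖φ (X s)‖ ^ 2) ∂(surfaceMeasure X)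
      ≤ ENNReal.ofReal t * ∫⁻ x in Ωext, ENNReal.ofReal (2 * ‖φ x‖ * gradNorm φ x) := by
        gcongr
        exact hX.lintegral_trace_le hφ hc
    _ = ∫⁻ x in Ωext, ENNReal.ofReal (t * (2 * ‖φ x‖ * gradNorm φ x)) := by
        rw [← lintegral_const_mul' _ _ ENNReal.ofReal_ne_top]
        simp_rw [ENNReal.ofReal_mul ht.le]
    _ ≤ ∫⁻ x in Ωext, (ENNReal.ofReal (gradNorm φ x ^ 2)
          + ENNReal.ofReal (t ^ 2) * ENNReal.ofReal (‖φ x‖ ^ 2)) := by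
        gcongr with x
        rw [← ENNReal.ofReal_mul (by positivity), ← ENNReal.ofReal_add (by positivity) (by positivity)]
        apply ENNReal.ofReal_le_ofReal
        nlinarith [sq_nonneg (gradNorm φ x - t * ‖φ x‖)]
    _ = (∫⁻ x in Ωext, ENNReal.ofReal (gradNorm φ x ^ 2))
          + ENNReal.ofReal (t ^ 2) * ∫⁻ x in Ωext, ENNReal.ofReal (‖φ x‖ ^ 2) := by
        rw [lintegral_add_right _ (by fun_prop), lintegral_const_mul _ hmφ]
    _ ≤ (∫⁻ x, ENNReal.ofReal (gradNorm φ x ^ 2))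
          + ENNReal.ofReal (t ^ 2) * ∫⁻ x in Ωext, ENNReal.ofReal (‖φ x‖ ^ 2) := by
        gcongr
        exact Measure.restrict_le_self
    _ = _ := by
        simp_rw [ofReal_gradNorm_sq]
        rw [lintegral_finsetSum _ (by fun_prop), ENNReal.ofReal_add (by positivity) (by positivity),
          ENNReal.ofReal_sum_of_nonneg (by intros; positivity), ENNReal.ofReal_mul (by positivity), hr]
        simp_rw [hd]

theorem IsAdmissibleSurface.memLp_comp (hX : IsAdmissibleSurface X Ωint Ωext)
    {φ : 𝓢(Space, ℂ)} (hc : HasCompactSupport φ) :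
    MemLp (fun s => φ (X s)) 2 (surfaceMeasure X) := by
  have hcont : Continuous fun s => φ (X s) := φ.continuous.comp hX.isEmbedding.continuous
  refine ⟨hcont.aestronglyMeasurable, ?_⟩
  have h := hX.mul_lintegral_trace_le hc one_pos
  rw [ENNReal.ofReal_one, one_mul] at h
  rw [eLpNorm_lt_top_iff_lintegral_rpow_enorm_lt_top (by simp) (by simp)]
  refine lt_of_eq_of_lt ?_ (h.trans_lt ENNReal.ofReal_lt_top)
  refine lintegral_congr fun s => ?_
  rw [ENNReal.ofReal_pow (norm_nonneg _), ofReal_norm]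
  simp

/-- The restriction of test functions to the surface. -/
def testTrace (hX : IsAdmissibleSurface X Ωint Ωext) :
    testFunctions →ₗ[ℂ] Lp ℂ 2 (surfaceMeasure X) where
  toFun φ := (hX.memLp_comp φ.2).toLp _
  map_add' _ _ := rfl
  map_smul' _ _ := rfl

/-- The trace operator on `H¹`, the continuous extension of the restriction of test functions. -/
def traceCLM (hX : IsAdmissibleSurface X Ωint Ωext) :
    sobolevSpace →L[ℂ] Lp ℂ 2 (surfaceMeasure X) :=
  (testTrace hX).extendOfNorm testToSobolev

theorem mul_norm_sq_testTrace_le (hX : IsAdmissibleSurface X Ωint Ωext) (φ : testFunctions)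
    {t : ℝ} (ht : 0 < t) :
    t * ‖testTrace hX φ‖ ^ 2 ≤ (∑ i, ‖sobolevDeriv i (testToSobolev φ)‖ ^ 2)
      + t ^ 2 * ‖restrictL2 Ωext (sobolevToL2 (testToSobolev φ))‖ ^ 2 := by
  have h := hX.mul_lintegral_trace_le φ.2 ht
  rw [← ofReal_norm_sq_toLp (hX.memLp_comp φ.2), ← ENNReal.ofReal_mul ht.le,
    ENNReal.ofReal_le_ofReal_iff (by positivity)] at h
  exact h

theorem traceCLM_test (hX : IsAdmissibleSurface X Ωint Ωext) (φ : testFunctions) :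
    traceCLM hX (testToSobolev φ) = testTrace hX φ := by
  refine LinearMap.extendOfNorm_eq denseRange_testToSobolev ⟨1, fun φ => ?_⟩ φ
  have h := mul_norm_sq_testTrace_le hX φ one_pos
  rw [one_mul]
  refine le_of_sq_le_sq ?_ (norm_nonneg _)
  rw [norm_sq_sobolevSpace]
  have h1 := norm_restrictL2_le Ωext (sobolevToL2 (testToSobolev φ))
  have h2 := pow_le_pow_left₀ (norm_nonneg _) h1 2
  linarith

/-- The trace inequality on `H¹`. -/
theorem mul_norm_sq_traceCLM_le (hX : IsAdmissibleSurface X Ωint Ωext) {t : ℝ} (ht : 0 < t)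
    (p : sobolevSpace) :
    t * ‖traceCLM hX p‖ ^ 2 ≤ (∑ i, ‖sobolevDeriv i p‖ ^ 2)
      + t ^ 2 * ‖restrictL2 Ωext (sobolevToL2 p)‖ ^ 2 := by
  refine denseRange_testToSobolev.induction (P := fun p => t * ‖traceCLM hX p‖ ^ 2
    ≤ (∑ i, ‖sobolevDeriv i p‖ ^ 2) + t ^ 2 * ‖restrictL2 Ωext (sobolevToL2 p)‖ ^ 2) ?_
    (isClosed_le (by fun_prop) (by fun_prop)) p
  rintro _ ⟨φ, rfl⟩
  rw [traceCLM_test]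
  exact mul_norm_sq_testTrace_le hX φ ht

theorem tendsto_toLp_iff {β : Type*} [MeasurableSpace β] {μ : Measure β} {f : ℕ → β → ℂ}
    (hf : ∀ n, MemLp (f n) 2 μ) (u : Lp ℂ 2 μ) :
    Tendsto (fun n => eLpNorm (fun x => f n x - u x) 2 μ) atTop (𝓝 0)
      ↔ Tendsto (fun n => (hf n).toLp (f n)) atTop (𝓝 u) := by
  rw [Lp.tendsto_Lp_iff_tendsto_eLpNorm']
  refine tendsto_congr fun n => eLpNorm_congr_ae ?_
  filter_upwards [(hf n).coeFn_toLp] with x hx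
  rw [Pi.sub_apply, hx]

theorem tendsto_sobolevSpace_iff {p : ℕ → sobolevSpace} {p₀ : sobolevSpace} :
    Tendsto p atTop (𝓝 p₀) ↔ Tendsto (fun n => sobolevToL2 (p n)) atTop (𝓝 (sobolevToL2 p₀)) ∧
      ∀ i, Tendsto (fun n => sobolevDeriv i (p n)) atTop (𝓝 (sobolevDeriv i p₀)) := by
  constructor
  · intro h
    exact ⟨(sobolevToL2.continuous.tendsto p₀).comp h,
      fun i => ((sobolevDeriv i).continuous.tendsto p₀).comp h⟩
  · rintro ⟨h0, hd⟩
    rw [tendsto_iff_norm_sub_tendsto_zero] at h0 ⊢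
    have h1 : Tendsto (fun n => ‖p n - p₀‖ ^ 2) atTop (𝓝 0) := by
      have h2 : ∀ i, Tendsto (fun n => ‖sobolevDeriv i (p n - p₀)‖ ^ 2) atTop (𝓝 0) := by
        intro i
        have := (tendsto_iff_norm_sub_tendsto_zero.1 (hd i)).pow 2
        simpa using this
      have h3 : Tendsto (fun n => ‖sobolevToL2 (p n - p₀)‖ ^ 2) atTop (𝓝 0) := by
        simpa using h0.pow 2
      have h4 := h3.add (tendsto_finsetSum Finset.univ fun i _ => h2 i)
      simpa only [norm_sq_sobolevSpace, Finset.sum_const_zero, add_zero] using h4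
    have h5 := h1.sqrt
    simpa using h5

theorem tendsto_testToSobolev_iff (ψ : ℕ → testFunctions) (p : sobolevSpace) :
    Tendsto (fun n => testToSobolev (ψ n)) atTop (𝓝 p) ↔
      Tendsto (fun n => eLpNorm (fun x => (ψ n).1 x - sobolevToL2 p x) 2 volume) atTop (𝓝 0) ∧
      ∀ i, Tendsto (fun n => eLpNorm (fun x => fderiv ℝ (ψ n).1 x (stdVec i)
        - weakGradient (sobolevToL2 p) i x) 2 volume) atTop (𝓝 0) := by
  have hd : ∀ i n x, fderiv ℝ (ψ n).1 x (stdVec i) = (∂_{stdVec i} (ψ n).1) x := fun _ _ _ => rfl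
  simp only [weakGradient_sobolevToL2, hd]
  rw [tendsto_sobolevSpace_iff]
  refine and_congr ?_ (forall_congr' fun i => ?_)
  · exact (tendsto_toLp_iff (fun n => (ψ n).1.memLp 2) (sobolevToL2 p)).symm
  · have h : ∀ n, sobolevDeriv i (testToSobolev (ψ n)) = (∂_{stdVec i} (ψ n).1).toLp 2 :=
      fun n => sobolevDeriv_schwartz _ i
    simp only [h]
    exact (tendsto_toLp_iff (f := fun n x => (∂_{stdVec i} (ψ n).1) x)
      (fun n => (∂_{stdVec i} (ψ n).1).memLp 2) (sobolevDeriv i p)).symm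

theorem tendsto_testTrace_iff (hX : IsAdmissibleSurface X Ωint Ωext) (ψ : ℕ → testFunctions)
    (τ : Lp ℂ 2 (surfaceMeasure X)) : Tendsto (fun n => testTrace hX (ψ n)) atTop (𝓝 τ) ↔
      Tendsto (fun n => eLpNorm (fun s => (ψ n).1 (X s) - τ s) 2 (surfaceMeasure X))
        atTop (𝓝 0) :=
  (tendsto_toLp_iff (fun n => hX.memLp_comp (ψ n).2) τ).symm

/-- The trace defined by approximating sequences exists, is unique and is given by the trace
operator. -/
theorem isTrace_iff (hX : IsAdmissibleSurface X Ωint Ωext) (p : sobolevSpace)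
    (τ : Lp ℂ 2 (surfaceMeasure X)) : IsTrace X (sobolevToL2 p) τ ↔ τ = traceCLM hX p := by
  have htr : ∀ ψ : ℕ → testFunctions, Tendsto (fun n => testToSobolev (ψ n)) atTop (𝓝 p) →
      Tendsto (fun n => testTrace hX (ψ n)) atTop (𝓝 (traceCLM hX p)) := by
    intro ψ hψ
    simp_rw [← traceCLM_test]
    exact ((traceCLM hX).continuous.tendsto p).comp hψ
  constructor
  · rintro ⟨φ, hφ, h0, hd, hτ⟩
    let ψ : ℕ → testFunctions := fun n => ⟨(hφ n).2.toSchwartzMap (hφ n).1, (hφ n).2⟩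
    have hψ := htr ψ ((tendsto_testToSobolev_iff ψ p).2 ⟨h0, hd⟩)
    exact tendsto_nhds_unique ((tendsto_testTrace_iff hX ψ τ).2 hτ) hψ
  · rintro rfl
    obtain ⟨q, hq, hlim⟩ := mem_closure_iff_seq_limit.1 (denseRange_testToSobolev p)
    choose ψ hψ using hq
    obtain rfl : (fun n => testToSobolev (ψ n)) = q := funext hψ
    obtain ⟨h0, hd⟩ := (tendsto_testToSobolev_iff ψ p).1 hlim
    exact ⟨fun n => (ψ n).1, fun n => ⟨(ψ n).1.smooth _, (ψ n).2⟩, h0, hd,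
      (tendsto_testTrace_iff hX ψ _).1 (htr ψ hlim)⟩

theorem trace_sobolevToL2 (hX : IsAdmissibleSurface X Ωint Ωext) (p : sobolevSpace) :
    trace X (sobolevToL2 p) = traceCLM hX p := by
  have hex : ∃ τ, IsTrace X (sobolevToL2 p) τ := ⟨_, (isTrace_iff hX p _).2 rfl⟩
  rw [trace, dif_pos hex]
  exact (isTrace_iff hX p _).1 hex.choose_spec

end TraceOperator

/-! ### The quadratic form -/

section Form

variable {X : Plane → Space} {Ωint Ωext : Set Space}

/-- The bounded operator on `H¹` which represents the quadratic form. -/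
def formOperator (hX : IsAdmissibleSurface X Ωint Ωext) (α V₀ : ℝ) :
    sobolevSpace →L[ℂ] sobolevSpace :=
  (∑ i, ContinuousLinearMap.adjoint (sobolevDeriv i) ∘L sobolevDeriv i)
    + (V₀ : ℂ) • (ContinuousLinearMap.adjoint (restrictL2 Ωext ∘L sobolevToL2) ∘L
        (restrictL2 Ωext ∘L sobolevToL2))
    - (α : ℂ) • (ContinuousLinearMap.adjoint (traceCLM hX) ∘L traceCLM hX)

theorem inner_formOperator (hX : IsAdmissibleSurface X Ωint Ωext) (α V₀ : ℝ)
    (v w : sobolevSpace) :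
    ⟪v, formOperator hX α V₀ w⟫_ℂ = (∑ i, ⟪sobolevDeriv i v, sobolevDeriv i w⟫_ℂ)
      + V₀ * ⟪restrictL2 Ωext (sobolevToL2 v), restrictL2 Ωext (sobolevToL2 w)⟫_ℂ
      - α * ⟪traceCLM hX v, traceCLM hX w⟫_ℂ := by
  simp [formOperator, sum_apply, ContinuousLinearMap.adjoint_inner_right]

theorem formOperator_symm (hX : IsAdmissibleSurface X Ωint Ωext) (α V₀ : ℝ)
    (v w : sobolevSpace) :
    ⟪formOperator hX α V₀ v, w⟫_ℂ = ⟪v, formOperator hX α V₀ w⟫_ℂ := by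
  refine (inner_conj_symm (formOperator hX α V₀ v) w).symm.trans ?_
  rw [inner_formOperator, inner_formOperator]
  simp only [map_sub, map_add, map_mul, map_sum, inner_conj_symm, Complex.conj_ofReal]

theorem deltaForm_sobolevToL2 (hX : IsAdmissibleSurface X Ωint Ωext) (α V₀ : ℝ)
    (v w : sobolevSpace) :
    deltaForm α (bias Ωext V₀) X (sobolevToL2 v) (sobolevToL2 w)
      = ⟪v, formOperator hX α V₀ w⟫_ℂ := by
  rw [inner_formOperator, deltaForm, trace_sobolevToL2 hX, trace_sobolevToL2 hX,
    integral_bias hX.divides.isOpen_ext.measurableSet]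
  simp only [weakGradient_sobolevToL2]

theorem re_inner_formOperator (hX : IsAdmissibleSurface X Ωint Ωext) (α V₀ : ℝ)
    (v : sobolevSpace) :
    (⟪v, formOperator hX α V₀ v⟫_ℂ).re = (∑ i, ‖sobolevDeriv i v‖ ^ 2)
      + V₀ * ‖restrictL2 Ωext (sobolevToL2 v)‖ ^ 2 - α * ‖traceCLM hX v‖ ^ 2 := by
  have h : ∀ {E : Type} [NormedAddCommGroup E] [InnerProductSpace ℂ E] (x : E),
      (⟪x, x⟫_ℂ).re = ‖x‖ ^ 2 := fun x => inner_self_eq_norm_sq (𝕜 := ℂ) x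
  rw [inner_formOperator, Complex.sub_re, Complex.add_re, Complex.re_sum, Complex.re_ofReal_mul,
    Complex.re_ofReal_mul]
  simp only [h]

/-- The form is nonnegative, by the trace inequality with the parameter `α`. -/
theorem formOperator_nonneg (hX : IsAdmissibleSurface X Ωint Ωext) {α V₀ : ℝ} (hα : 0 < α)
    (hV : α ^ 2 ≤ V₀) (v : sobolevSpace) : 0 ≤ (⟪v, formOperator hX α V₀ v⟫_ℂ).re := by
  rw [re_inner_formOperator]
  have h1 := mul_norm_sq_traceCLM_le hX hα v
  have h2 := mul_le_mul_of_nonneg_right hV (sq_nonneg ‖restrictL2 Ωext (sobolevToL2 v)‖)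
  linarith

/-- The form controls the norm of `H¹`, because half of the gradient suffices to control the
trace. -/
theorem exists_formOperator_coercive (hX : IsAdmissibleSurface X Ωint Ωext) {α V₀ : ℝ}
    (hα : 0 < α) (hV : α ^ 2 ≤ V₀) : ∃ c : ℝ, 0 < c ∧ ∀ v : sobolevSpace,
      c * ‖v‖ ^ 2 ≤ (⟪v, formOperator hX α V₀ v⟫_ℂ).re + ‖sobolevToL2 v‖ ^ 2 := by
  -- a small multiple `θ` of the bound `½ ‖∇v‖² - 2 α² ‖v‖²` of the form, whose negative part is
  -- at most `½ ‖v‖²`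
  let θ : ℝ := (1 + 4 * α ^ 2)⁻¹
  have hθ : 0 < θ := by positivity
  have hθ1 : θ * (1 + 4 * α ^ 2) = 1 := inv_mul_cancel₀ (by positivity)
  have hθ2 : θ ≤ 1 := inv_le_one_of_one_le₀ (by nlinarith)
  refine ⟨θ / 2, by positivity, fun v => ?_⟩
  have h0 := formOperator_nonneg hX hα hV v
  have h1 := mul_norm_sq_traceCLM_le hX (mul_pos two_pos hα) v
  have h2 : 0 ≤ V₀ * ‖restrictL2 Ωext (sobolevToL2 v)‖ ^ 2 := by
    have : 0 ≤ V₀ := (sq_nonneg α).trans hV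
    positivity
  have h3 := pow_le_pow_left₀ (norm_nonneg _) (norm_restrictL2_le Ωext (sobolevToL2 v)) 2
  have h4 := re_inner_formOperator hX α V₀ v
  rw [norm_sq_sobolevSpace]
  set r := (⟪v, formOperator hX α V₀ v⟫_ℂ).re
  set G := ∑ i, ‖sobolevDeriv i v‖ ^ 2
  set u := ‖sobolevToL2 v‖ ^ 2
  have hu : 0 ≤ u := by positivity
  have h5 : G / 2 - 2 * α ^ 2 * u ≤ r := by
    have := mul_le_mul_of_nonneg_left h3 (sq_nonneg α)
    nlinarith
  have h6 : θ * (G / 2 - 2 * α ^ 2 * u) ≤ r :=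
    (mul_le_mul_of_nonneg_left h5 hθ.le).trans (mul_le_of_le_one_left h0 hθ2)
  have h7 : 2 * (θ * α ^ 2) * u ≤ 1 / 2 * u := by
    gcongr
    linarith
  nlinarith

theorem isClosedSemiboundedForm_deltaForm (hX : IsAdmissibleSurface X Ωint Ωext) {α V₀ : ℝ}
    (hα : 0 < α) (hV : α ^ 2 ≤ V₀) :
    IsClosedSemiboundedForm H1 (deltaForm α (bias Ωext V₀) X) := by
  obtain ⟨c, hc, hco⟩ := exists_formOperator_coercive hX hα hV
  have hq := deltaForm_sobolevToL2 hX α V₀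
  rw [← range_sobolevToL2]
  refine ⟨denseRange_sobolevToL2, ⟨0, ?_⟩, ?_⟩
  · rintro _ ⟨p, rfl⟩
    rw [hq]
    simpa using formOperator_nonneg hX hα hV p
  · intro u v hu huv hcau
    choose p hp using hu
    obtain rfl : (fun n => sobolevToL2 (p n)) = u := funext hp
    simp only [← map_sub, hq] at hcau
    -- by coercivity, a sequence which is Cauchy in the form sense is Cauchy in `H¹`
    have hcauchy : CauchySeq p := by
      rw [Metric.cauchySeq_iff]
      intro ε hε
      obtain ⟨N₁, hN₁⟩ := hcau (c * ε ^ 2 / 2) (by positivity)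
      obtain ⟨N₂, hN₂⟩ := Metric.cauchySeq_iff.1 huv.cauchySeq (√(c * ε ^ 2 / 2)) (by positivity)
      refine ⟨max N₁ N₂, fun m hm n hn => ?_⟩
      have h1 := hN₁ m (le_of_max_le_left hm) n (le_of_max_le_left hn)
      have h2 := hN₂ m (le_of_max_le_right hm) n (le_of_max_le_right hn)
      rw [dist_eq_norm, ← map_sub] at h2
      have h3 := hco (p m - p n)
      have h4 := (Complex.re_le_norm _).trans_lt h1
      have h5 : ‖sobolevToL2 (p m - p n)‖ ^ 2 < c * ε ^ 2 / 2 := (Real.lt_sqrt (norm_nonneg _)).1 h2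
      rw [dist_eq_norm]
      refine lt_of_pow_lt_pow_left₀ 2 hε.le ?_
      refine lt_of_mul_lt_mul_left ?_ hc.le
      linarith
    obtain ⟨p₀, hp₀⟩ := cauchySeq_tendsto_of_complete hcauchy
    obtain rfl : sobolevToL2 p₀ = v :=
      tendsto_nhds_unique ((sobolevToL2.continuous.tendsto p₀).comp hp₀) huv
    refine ⟨⟨p₀, rfl⟩, ?_⟩
    simp only [← map_sub, hq]
    have h1 : Tendsto (fun n => p n - p₀) atTop (𝓝 0) := tendsto_sub_nhds_zero_iff.2 hp₀
    have h2 : Continuous fun w : sobolevSpace => ⟪w, formOperator hX α V₀ w⟫_ℂ :=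
      continuous_id.inner (formOperator hX α V₀).continuous
    have h3 := (h2.tendsto 0).comp h1
    rwa [map_zero, inner_zero_right] at h3

theorem exists_selfAdjoint_deltaForm (hX : IsAdmissibleSurface X Ωint Ωext) {α V₀ : ℝ}
    (hα : 0 < α) (hV : α ^ 2 ≤ V₀) : ∃ H : L2 →ₗ.[ℂ] L2,
      IsAssociatedOperator H1 (deltaForm α (bias Ωext V₀) X) H ∧ IsSelfAdjoint H ∧
        opSpectrum H ⊆ Complex.ofReal '' Ici 0 := by
  obtain ⟨c, hc, hco⟩ := exists_formOperator_coercive hX hα hV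
  rw [← range_sobolevToL2]
  exact exists_selfAdjoint_of_form sobolevToL2 sobolevToL2_injective denseRange_sobolevToL2
    (formOperator hX α V₀) (formOperator_symm hX α V₀) (formOperator_nonneg hX hα hV) hc hco _
    (deltaForm_sobolevToL2 hX α V₀)

end Form

/-! ### Wave packets in large balls -/

section WeylSequence

variable {X : Plane → Space} {Ωint Ωext : Set Space}

/-- Integration by parts. -/
theorem inner_sobolevDeriv_toLp (p : sobolevSpace) (i : Fin 3) (g : 𝓢(Space, ℂ)) :
    ⟪sobolevDeriv i p, g.toLp 2⟫_ℂ = -⟪sobolevToL2 p, (∂_{stdVec i} g).toLp 2⟫_ℂ := by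
  have h : ⟪g.toLp 2, sobolevDeriv i p⟫_ℂ = -⟪(∂_{stdVec i} g).toLp 2, sobolevToL2 p⟫_ℂ := by
    have h1 := DFunLike.congr_fun (isWeakGradient_sobolev p i) (conjSchwartz g)
    rw [TemperedDistribution.lineDerivOp_apply_apply, map_neg,
      Lp.toTemperedDistribution_apply (sobolevDeriv i p),
      Lp.toTemperedDistribution_apply (sobolevToL2 p)] at h1
    rw [inner_toLp_schwartz, inner_toLp_schwartz]
    simp only [lineDeriv_conjSchwartz, conjSchwartz_apply, smul_eq_mul] at h1
    exact h1.symm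
  have h2 := congrArg (starRingEnd ℂ) h
  rwa [inner_conj_symm, map_neg, inner_conj_symm] at h2

/-- On functions supported in the interior region, the operator of the form is the free
Laplacian. -/
theorem mem_graph_of_support_subset (hX : IsAdmissibleSurface X Ωint Ωext) {α V₀ : ℝ}
    {H : L2 →ₗ.[ℂ] L2} (hH : IsAssociatedOperator H1 (deltaForm α (bias Ωext V₀) X) H)
    (ψ : testFunctions) (hψ : ∀ x ∉ Ωint, ψ.1 x = 0) :
    (ψ.1.toLp 2 volume, -∑ i, (∂_{stdVec i} (∂_{stdVec i} ψ.1)).toLp 2 volume) ∈ H.graph := by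
  rw [hH, ← range_sobolevToL2]
  refine ⟨⟨testToSobolev ψ, rfl⟩, ?_⟩
  have hr : restrictL2 Ωext (sobolevToL2 (testToSobolev ψ)) = 0 := by
    refine Lp.ext ?_
    filter_upwards [LpToLpRestrictCLM_coeFn ℂ Ωext (sobolevToL2 (testToSobolev ψ)),
      ae_restrict_of_ae (ψ.1.coeFn_toLp 2 volume), Lp.coeFn_zero ℂ 2 (volume.restrict Ωext),
      ae_restrict_mem hX.divides.isOpen_ext.measurableSet] with x h1 h2 h3 h4
    rw [restrictL2, h1, h3]
    exact h2.trans (hψ x (disjoint_right.1 hX.divides.disjoint h4))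
  have htr : traceCLM hX (testToSobolev ψ) = 0 := by
    rw [traceCLM_test]
    refine Lp.ext ?_
    filter_upwards [(hX.memLp_comp ψ.2).coeFn_toLp, Lp.coeFn_zero ℂ 2 (surfaceMeasure X)]
      with s h1 h2
    rw [h2]
    refine h1.trans (hψ _ fun hs => ?_)
    have h3 : X s ∈ (range X)ᶜ := hX.divides.union_eq ▸ Or.inl hs
    exact h3 ⟨s, rfl⟩
  rintro _ ⟨p, rfl⟩
  have hform := deltaForm_sobolevToL2 hX α V₀ p (testToSobolev ψ)
  rw [inner_formOperator, hr, htr, inner_zero_right, inner_zero_right, mul_zero, mul_zero,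
    add_zero, sub_zero] at hform
  refine hform.trans ?_
  rw [inner_neg_right, inner_sum, ← Finset.sum_neg_distrib]
  exact Finset.sum_congr rfl fun i _ => inner_sobolevDeriv_toLp p i _

theorem hasCompactSupport_lineDeriv {g : 𝓢(Space, ℂ)} (hg : HasCompactSupport g) (v : Space) :
    HasCompactSupport (∂_{v} g : 𝓢(Space, ℂ)) :=
  HasCompactSupport.fderiv_apply (𝕜 := ℝ) hg v

/-- The derivative of a test function. -/
def testDeriv (v : Space) (g : testFunctions) : testFunctions :=
  ⟨∂_{v} g.1, hasCompactSupport_lineDeriv g.2 v⟩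

/-- The plane wave `exp (i k x 0)`, in the direction of the first axis, times the profile `g`
dilated by the factor `R` and centred at `x₀`. -/
def wavePacket (k R : ℝ) (x₀ : Space) (g : Space → ℂ) (x : Space) : ℂ :=
  g (R⁻¹ • (x - x₀)) * Complex.exp (Complex.I * k * (x 0 : ℂ))

theorem contDiff_wavePacket (k R : ℝ) (x₀ : Space) (g : testFunctions) :
    ContDiff ℝ ∞ (wavePacket k R x₀ g.1) := by
  have h0 : ContDiff ℝ ∞ fun x : Space => (x 0 : ℂ) :=
    Complex.ofRealCLM.contDiff.comp (EuclideanSpace.proj (0 : Fin 3) : Space →L[ℝ] ℝ).contDiff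
  have h1 : ContDiff ℝ ∞ fun x : Space => R⁻¹ • (x - x₀) := by fun_prop
  exact ((g.1.smooth _).comp h1).mul
    (Complex.contDiff_exp.comp (contDiff_const.mul h0))

theorem hasCompactSupport_wavePacket (k : ℝ) {R : ℝ} (hR : R ≠ 0) (x₀ : Space)
    (g : testFunctions) : HasCompactSupport (wavePacket k R x₀ g.1) := by
  have h0 : HasCompactSupport fun x : Space => g.1 (R⁻¹ • x) :=
    HasCompactSupport.comp_smul g.2 (inv_ne_zero hR)
  have h1 : HasCompactSupport fun x : Space => g.1 (R⁻¹ • (x - x₀)) :=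
    h0.comp_homeomorph (Homeomorph.subRight x₀)
  exact h1.mul_right

/-- The wave packet as a test function. -/
def testWavePacket (k : ℝ) {R : ℝ} (hR : R ≠ 0) (x₀ : Space) (g : testFunctions) :
    testFunctions :=
  ⟨(hasCompactSupport_wavePacket k hR x₀ g).toSchwartzMap (contDiff_wavePacket k R x₀ g),
    hasCompactSupport_wavePacket k hR x₀ g⟩

theorem testWavePacket_apply (k : ℝ) {R : ℝ} (hR : R ≠ 0) (x₀ : Space) (g : testFunctions)
    (x : Space) : (testWavePacket k hR x₀ g).1 x = wavePacket k R x₀ g.1 x := rfl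

theorem lineDeriv_testWavePacket (k : ℝ) {R : ℝ} (hR : R ≠ 0) (x₀ v : Space)
    (g : testFunctions) :
    ∂_{v} (testWavePacket k hR x₀ g).1
      = (R⁻¹ : ℂ) • (testWavePacket k hR x₀ (testDeriv v g)).1
        + (Complex.I * k * (v 0 : ℂ)) • (testWavePacket k hR x₀ g).1 := by
  ext x
  have h1 : HasFDerivAt (fun x : Space => R⁻¹ • (x - x₀))
      (R⁻¹ • ContinuousLinearMap.id ℝ Space) x :=
    ((hasFDerivAt_id x).sub_const x₀).const_smul R⁻¹
  have h2 := (g.1.hasFDerivAt (R⁻¹ • (x - x₀))).comp x h1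
  have h3 : HasFDerivAt (fun x : Space => (x 0 : ℂ))
      (Complex.ofRealCLM ∘L (EuclideanSpace.proj (0 : Fin 3) : Space →L[ℝ] ℝ)) x :=
    (Complex.ofRealCLM ∘L (EuclideanSpace.proj (0 : Fin 3) : Space →L[ℝ] ℝ)).hasFDerivAt
  have h4 := (h3.const_mul (Complex.I * k)).cexp
  have h5 := (h2.mul h4).fderiv
  rw [SchwartzMap.lineDerivOp_apply_eq_fderiv]
  have h6 : ((testWavePacket k hR x₀ g).1 : Space → ℂ)
      = (g.1 ∘ fun x => R⁻¹ • (x - x₀)) * fun x => Complex.exp (Complex.I * k * (x 0 : ℂ)) := rfl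
  have h7 : (testWavePacket k hR x₀ (testDeriv v g)).1 x
      = fderiv ℝ g.1 (R⁻¹ • (x - x₀)) v * Complex.exp (Complex.I * k * (x 0 : ℂ)) := rfl
  rw [add_apply, smul_apply, smul_apply, h7, h6]
  refine (congrArg (fun L : Space →L[ℝ] ℂ => L v) h5).trans ?_
  simp
  ring

theorem norm_testWavePacket (k : ℝ) {R : ℝ} (hR : 0 < R) (x₀ : Space) (g : testFunctions) :
    ‖(testWavePacket k hR.ne' x₀ g).1.toLp 2‖ = √(R ^ 3) * ‖g.1.toLp 2‖ := by
  have hn : ∀ φ : 𝓢(Space, ℂ), ‖φ.toLp 2‖ ^ 2 = ∫ x, ‖φ x‖ ^ 2 := by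
    intro φ
    have h1 := ofReal_norm_sq_toLp (φ.memLp 2 volume)
    rw [integral_eq_lintegral_of_nonneg_ae (ae_of_all _ fun x => sq_nonneg _)
      (by fun_prop), ← h1]
    exact (ENNReal.toReal_ofReal (sq_nonneg _)).symm
  have hexp : ∀ x : Space, ‖Complex.exp (Complex.I * k * (x 0 : ℂ))‖ = 1 := by
    intro x
    rw [Complex.norm_exp]
    simp
  have h2 : ‖(testWavePacket k hR.ne' x₀ g).1.toLp 2‖ ^ 2 = R ^ 3 * ‖g.1.toLp 2‖ ^ 2 := by
    rw [hn, hn]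
    simp only [testWavePacket_apply, wavePacket, norm_mul, hexp, mul_one]
    rw [integral_sub_right_eq_self (fun x : Space => ‖g.1 (R⁻¹ • x)‖ ^ 2) x₀,
      Measure.integral_comp_inv_smul volume (fun x : Space => ‖g.1 x‖ ^ 2) R]
    simp [abs_of_pos hR]
  rw [← Real.sqrt_sq (norm_nonneg _), h2, Real.sqrt_mul (by positivity),
    Real.sqrt_sq (norm_nonneg _)]

theorem lineDeriv_lineDeriv_testWavePacket (k : ℝ) {R : ℝ} (hR : R ≠ 0) (x₀ v : Space)
    (g : testFunctions) :
    ∂_{v} (∂_{v} (testWavePacket k hR x₀ g).1)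
      = (R⁻¹ ^ 2 : ℂ) • (testWavePacket k hR x₀ (testDeriv v (testDeriv v g))).1
        + (R⁻¹ * (2 * Complex.I * k) * v 0 : ℂ) • (testWavePacket k hR x₀ (testDeriv v g)).1
        - (k ^ 2 * (v 0) ^ 2 : ℂ) • (testWavePacket k hR x₀ g).1 := by
  rw [lineDeriv_testWavePacket, LineDeriv.lineDerivOp_add, LineDeriv.lineDerivOp_smul,
    LineDeriv.lineDerivOp_smul, lineDeriv_testWavePacket, lineDeriv_testWavePacket]
  ext x
  simp only [add_apply, sub_apply, smul_apply, smul_eq_mul, Complex.ofReal_inv]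
  linear_combination (k ^ 2 * (v 0) ^ 2 * (testWavePacket k hR x₀ g).1 x : ℂ) * Complex.I_mul_I

theorem sum_lineDeriv_testWavePacket (k : ℝ) {R : ℝ} (hR : R ≠ 0) (x₀ : Space)
    (g : testFunctions) :
    ∑ i, (∂_{stdVec i} (∂_{stdVec i} (testWavePacket k hR x₀ g).1)).toLp 2 volume
      = (R⁻¹ ^ 2 : ℂ) • (∑ i, (testWavePacket k hR x₀
            (testDeriv (stdVec i) (testDeriv (stdVec i) g))).1.toLp 2 volume : L2)
        + (R⁻¹ * (2 * Complex.I * k) : ℂ) •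
            (testWavePacket k hR x₀ (testDeriv (stdVec 0) g)).1.toLp 2 volume
        - ((k ^ 2 : ℝ) : ℂ) • (testWavePacket k hR x₀ g).1.toLp 2 volume := by
  have h : ∀ i, (∂_{stdVec i} (∂_{stdVec i} (testWavePacket k hR x₀ g).1)).toLp 2 volume
      = (R⁻¹ ^ 2 : ℂ) • ((testWavePacket k hR x₀
            (testDeriv (stdVec i) (testDeriv (stdVec i) g))).1.toLp 2 volume : L2)
        + ((R⁻¹ * (2 * Complex.I * k) * stdVec i 0 : ℂ) •
            (testWavePacket k hR x₀ (testDeriv (stdVec i) g)).1.toLp 2 volume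
        - (k ^ 2 * (stdVec i 0) ^ 2 : ℂ) • (testWavePacket k hR x₀ g).1.toLp 2 volume) := by
    intro i
    rw [lineDeriv_lineDeriv_testWavePacket, add_sub_assoc]
    have hL : ∀ φ : 𝓢(Space, ℂ), φ.toLp 2 volume = SchwartzMap.toLpCLM ℂ ℂ 2 volume φ :=
      fun _ => rfl
    simp only [hL, map_add, map_sub, map_smul]
  have h0 : (stdVec 0) 0 = 1 := by simp
  have h1 : ∀ i : Fin 3, i ≠ 0 → (stdVec i) 0 = 0 := fun i hi => by simp [hi.symm]
  rw [Finset.sum_congr rfl fun i _ => h i, Finset.sum_add_distrib, ← Finset.smul_sum,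
    add_sub_assoc]
  congr 1
  rw [Finset.sum_eq_single 0 (fun i _ hi => by rw [h1 i hi]; simp) (by simp), h0]
  simp

/-- The profile of the wave packets. -/
def cutoffTest : testFunctions :=
  ⟨(hasCompactSupport_scaledCutoff 0).toSchwartzMap (contDiff_scaledCutoff 0),
    hasCompactSupport_scaledCutoff 0⟩

theorem cutoffTest_apply (x : Space) : cutoffTest.1 x = (cutoff x : ℂ) := by
  change scaledCutoff 0 x = _
  simp [scaledCutoff]

/-- Every nonnegative number is in the spectrum: wave packets of any size fit into the interior
region. -/
theorem ofReal_sq_mem_opSpectrum (hX : IsAdmissibleSurface X Ωint Ωext) {α V₀ : ℝ}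
    {H : L2 →ₗ.[ℂ] L2} (hH : IsAssociatedOperator H1 (deltaForm α (bias Ωext V₀) X) H) (k : ℝ) :
    ((k ^ 2 : ℝ) : ℂ) ∈ opSpectrum H := by
  rintro ⟨T, hT⟩
  set A : ℝ := ∑ i, ‖(testDeriv (stdVec i) (testDeriv (stdVec i) cutoffTest)).1.toLp 2 volume‖ with hA
  set B : ℝ := ‖(testDeriv (stdVec 0) cutoffTest).1.toLp 2 volume‖
  -- a bounded resolvent `T` at `k²` would satisfy `ψ = T (-Δψ - k² ψ)` for the wave packets `ψ`
  have hbound : ∀ R : ℝ, 0 < R →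
      ‖cutoffTest.1.toLp 2‖ ≤ ‖T‖ * (R⁻¹ ^ 2 * A + R⁻¹ * (2 * |k|) * B) := by
    intro R hR
    obtain ⟨x₀, hx₀⟩ := hX.exists_ball_subset (mul_pos two_pos hR)
    let ψ := testWavePacket k hR.ne' x₀ cutoffTest
    have hsupp : ∀ x ∉ Ωint, ψ.1 x = 0 := by
      intro x hx
      have h1 : ¬ ‖R⁻¹ • (x - x₀)‖ < 2 := by
        intro h
        rw [norm_smul, norm_inv, Real.norm_of_nonneg hR.le, inv_mul_lt_iff₀ hR, mul_comm] at h
        exact hx (hx₀ (mem_ball_iff_norm.2 h))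
      have h2 : cutoff (R⁻¹ • (x - x₀)) = 0 := by
        rw [← Function.notMem_support, cutoff.support_eq, mem_ball_zero_iff]
        exact h1
      rw [testWavePacket_apply, wavePacket, cutoffTest_apply, h2, Complex.ofReal_zero, zero_mul]
    have hgraph := mem_graph_of_support_subset hX hH ψ hsupp
    rw [sum_lineDeriv_testWavePacket] at hgraph
    set a : L2 := ∑ i, (testWavePacket k hR.ne' x₀
      (testDeriv (stdVec i) (testDeriv (stdVec i) cutoffTest))).1.toLp 2 volume
    set b : L2 := (testWavePacket k hR.ne' x₀ (testDeriv (stdVec 0) cutoffTest)).1.toLp 2 volume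
    have hψ : ψ.1.toLp 2 = T (-((R⁻¹ ^ 2 : ℂ) • a + (R⁻¹ * (2 * Complex.I * k) : ℂ) • b)) := by
      rw [← hT]
      convert hgraph using 2
      abel
    have hna : ‖a‖ ≤ √(R ^ 3) * A := by
      rw [hA, Finset.mul_sum]
      refine (norm_sum_le _ _).trans_eq ?_
      exact Finset.sum_congr rfl fun i _ => norm_testWavePacket k hR x₀ _
    have hnb : ‖b‖ = √(R ^ 3) * B := norm_testWavePacket k hR x₀ _
    have h1 : ‖ψ.1.toLp 2‖ ≤ ‖T‖ * (R⁻¹ ^ 2 * ‖a‖ + R⁻¹ * (2 * |k|) * ‖b‖) := by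
      rw [hψ]
      refine (T.le_opNorm _).trans ?_
      gcongr
      rw [norm_neg]
      refine (norm_add_le _ _).trans_eq ?_
      rw [norm_smul, norm_smul]
      simp [abs_of_pos hR]
    have hs : 0 < √(R ^ 3) := by positivity
    refine le_of_mul_le_mul_left ?_ hs
    rw [← norm_testWavePacket k hR x₀]
    refine h1.trans ?_
    calc ‖T‖ * (R⁻¹ ^ 2 * ‖a‖ + R⁻¹ * (2 * |k|) * ‖b‖)
        ≤ ‖T‖ * (R⁻¹ ^ 2 * (√(R ^ 3) * A) + R⁻¹ * (2 * |k|) * (√(R ^ 3) * B)) := by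
          rw [hnb]
          gcongr
      _ = _ := by ring
  have hlim : Tendsto (fun R : ℝ => ‖T‖ * (R⁻¹ ^ 2 * A + R⁻¹ * (2 * |k|) * B)) atTop (𝓝 0) := by
    have h1 := tendsto_inv_atTop_zero (𝕜 := ℝ)
    simpa using (((h1.pow 2).mul_const A).add ((h1.mul_const (2 * |k|)).mul_const B)).const_mul ‖T‖
  have h0 : ‖cutoffTest.1.toLp 2‖ ≤ 0 := by
    refine ge_of_tendsto hlim ?_
    filter_upwards [eventually_gt_atTop 0] with R hR using hbound R hR
  have h1 : cutoffTest.1.toLp 2 = (0 : 𝓢(Space, ℂ)).toLp 2 volume :=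
    (norm_le_zero_iff.1 h0).trans (map_zero (SchwartzMap.toLpCLM ℂ ℂ 2 volume)).symm
  have h2 := DFunLike.congr_fun (SchwartzMap.injective_toLp 2 volume h1) 0
  rw [cutoffTest_apply, cutoff.one_of_mem_closedBall (Metric.mem_closedBall_self cutoff.rIn_pos.le)]
    at h2
  simp at h2

theorem discreteSpectrum_eq_empty {H : L2 →ₗ.[ℂ] L2}
    (hH : opSpectrum H = Complex.ofReal '' Ici 0) : discreteSpectrum H = ∅ := by
  refine eq_empty_of_forall_notMem ?_
  rintro z ⟨hz, ⟨ε, hε, hiso⟩, -⟩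
  rw [hH] at hz hiso
  obtain ⟨r, hr, rfl⟩ := hz
  rw [mem_Ici] at hr
  have h1 := hiso ((r + ε / 2 : ℝ) : ℂ) ⟨r + ε / 2, by rw [mem_Ici]; positivity, rfl⟩ (by
    rw [Complex.isometry_ofReal.dist_eq, Real.dist_eq, abs_lt]
    constructor <;> linarith)
  have h2 := Complex.ofReal_injective h1
  linarith

end WeylSequence

end SurfaceDelta

end

theorem theorem2p3 (X : SurfaceDelta.Plane → SurfaceDelta.Space)
    (Ωint Ωext : Set SurfaceDelta.Space)
    (hX : SurfaceDelta.IsAdmissibleSurface X Ωint Ωext)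
    (α V₀ : ℝ) (hα : 0 < α) (hV : α ^ 2 ≤ V₀) :
    SurfaceDelta.IsClosedSemiboundedForm SurfaceDelta.H1
        (SurfaceDelta.deltaForm α (SurfaceDelta.bias Ωext V₀) X) ∧
      ∃ H : SurfaceDelta.L2 →ₗ.[ℂ] SurfaceDelta.L2,
        SurfaceDelta.IsAssociatedOperator SurfaceDelta.H1
          (SurfaceDelta.deltaForm α (SurfaceDelta.bias Ωext V₀) X) H ∧
        IsSelfAdjoint H ∧
        SurfaceDelta.discreteSpectrum H = ∅ ∧
        SurfaceDelta.opSpectrum H = Complex.ofReal '' Set.Ici 0 ∧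
        SurfaceDelta.essentialSpectrum H = Complex.ofReal '' Set.Ici 0 := by
  obtain ⟨H, hH, hself, hspec⟩ := SurfaceDelta.exists_selfAdjoint_deltaForm hX hα hV
  have hspec' : SurfaceDelta.opSpectrum H = Complex.ofReal '' Set.Ici 0 := by
    refine hspec.antisymm ?_
    rintro _ ⟨r, hr, rfl⟩
    have h := SurfaceDelta.ofReal_sq_mem_opSpectrum hX hH √r
    rwa [Real.sq_sqrt hr] at h
  have hdisc := SurfaceDelta.discreteSpectrum_eq_empty hspec'
  refine ⟨SurfaceDelta.isClosedSemiboundedForm_deltaForm hX hα hV, H, hH, hself, hdisc, hspec', ?_⟩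
  rw [SurfaceDelta.essentialSpectrum, hdisc, Set.sdiff_empty, hspec']
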